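/- **Circuit.** Fix transmissivities $\eta_1,\dots,\eta_4\in(0,1)$, detector efficiencies $\epsilon_1,\dots,\epsilon_4\in(0,1]$, conversion factors $\xi_1,\dots,\xi_4>0$ and phases $\psi_1,\psi_2\in\mathbb R$. Eight Bose fields $A_1,\dots,A_4,A_{1+},\dots,A_{4+}$ (Fock representation over $L^2(\mathbb R)$) are transformed as follows: $B_1=\sqrt{\eta_1}A_1+i\sqrt{1-\eta_1}A_2$, $B_2=i\sqrt{1-\eta_1}A_1+\sqrt{\eta_1}A_2$, $B_3=e^{i\psi_1}[\sqrt{\eta_2}A_3+i\sqrt{1-\eta_2}A_4]$, $B_4=e^{i\psi_2}[i\sqrt{1-\eta_2}A_3+\sqrt{\eta_2}A_4]$; $C_1=\sqrt{\eta_3}B_1+i\sqrt{1-\eta_3}B_3$, $C_3=i\sqrt{1-\eta_3}B_1+\sqrt{\eta_3}B_3$, $C_2=\sqrt{\eta_4}B_2+i\sqrt{1-\eta_4}B_4$, $C_4=i\sqrt{1-\eta_4}B_2+\sqrt{\eta_4}B_4$; $D_j=\sqrt{\epsilon_j}C_j+i\sqrt{1-\epsilon_j}A_{j+}$, $D_{j+}=i\sqrt{1-\epsilon_j}C_j+\sqrt{\epsilon_j}A_{j+}$.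 Put $\kappa_{12}=\eta_2[(1-\eta_3)\epsilon_1\xi_1^2+\eta_3\epsilon_3\xi_3^2]$, $\kappa_{22}=(1-\eta_2)[(1-\eta_4)\epsilon_2\xi_2^2+\eta_4\epsilon_4\xi_4^2]$, $\kappa_{13}=\sqrt{\eta_1\eta_2\eta_3(1-\eta_3)}\,(\epsilon_1\xi_1+\epsilon_3\xi_3)$, $\kappa_{23}=\sqrt{(1-\eta_1)(1-\eta_2)\eta_4(1-\eta_4)}\,(\epsilon_2\xi_2+\epsilon_4\xi_4)$, $\Delta_{12}=\eta_2[(1-\eta_3)\epsilon_1\xi_1-\eta_3\epsilon_3\xi_3]$, $\Delta_{22}=(1-\eta_2)[(1-\eta_4)\epsilon_2\xi_2-\eta_4\epsilon_4\xi_4]$, $G_{13}=\frac{1-\eta_1}{\eta_1}$, $G_{23}=\frac{\eta_1}{1-\eta_1}$, $V_1^2=\frac{\Delta_{12}^2}{\eta_2\kappa_{13}^2}$, $V_2^2=\frac{\Delta_{22}^2}{(1-\eta_2)\kappa_{23}^2}$, $\sigma_1^2=\tilde\sigma_1^2/\eta_1$, $\sigma_2^2=\tilde\sigma_2^2/(1-\eta_1)$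 with $\tilde\sigma_j^2=\big[\frac{\epsilon_j(1-\epsilon_j)}{\eta_{j+2}}\xi_j^2+\frac{\epsilon_{j+2}(1-\epsilon_{j+2})}{1-\eta_{j+2}}\xi_{j+2}^2\big]\big/(\epsilon_j\xi_j+\epsilon_{j+2}\xi_{j+2})^2$, and let $\Xi$ be the symmetric $2\times2$ matrix with diagonal entries $G_{13},G_{23}$ and off-diagonal entry $-\cos(\psi_2-\psi_1)$. **State and observations.** Let $T>0$, and let $f_s,\tilde f$ be jointly measurable complex stochastic processes on a probability space, with expectation $\mathbb E_f$, whose paths are a.s. square integrable on $(0,T)$. For $L>0$ (the modulus $|\lambda|$ of the local-oscillator amplitude) put $f=L\tilde f$. Given $(f_s,\tilde f)$, the field $A_1$ (signal) is in the coherent state $|e_1(f_s\mathbf 1_{(0,T)})\rangle$, the field $A_3$ (local oscillator) in the coherent state $|e_3(f\mathbf 1_{(0,T)})\rangle$, the other six fields are in the vacuum; the total state is the $\mathbb E_f$-mixture of these states. Let $N_1,\dots,N_4$ be the counting processes obtained by measuring in this state the commuting number operators $\int_0^t d_j^\dagger d_j\,ds$ of $D_1,\dots,D_4$. Let $h\ge0$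 be measurable with $\int_0^\infty h=1$ and $$X_j(t)=\xi_j\int_0^t h(t-s)\,dN_j(s)-\xi_{j+2}\int_0^t h(t-s)\,dN_{j+2}(s),\qquad Z_j=\frac{\xi_jN_j-\xi_{j+2}N_{j+2}}{L\,\kappa_{j3}},\qquad j=1,2 .$$ Test functions are bounded, measurable and real-valued. **The functional $\Phi^Z_T$.** For $G_{12},G_{22}\in\mathbb R$ and $\vec k=(k_1,k_2)$ put $\Phi^Z_T[\vec k;f]=\mathrm{Tr}\big\{\hat\Psi^Q_T[\vec k;f]\,|e_1(f_s\mathbf 1_{(0,T)})\rangle\langle e_1(f_s\mathbf 1_{(0,T)})|\big\}\,\Gamma_T[\vec k;f]$, where $$\hat\Psi^Q_T[\vec k;f]=\exp\int_0^T\Big\{i\sum_{j}k_j\,d\hat Q_j-\tfrac12\sum_{i,j}k_j\Xi_{ji}k_i|\tilde f|^2dt\Big\},\qquad d\hat Q_j=ie^{i\psi_j}\tilde f\,dA_1^\dagger+\text{h.c.},$$ $$\Gamma_T[\vec k;f]=\exp\int_0^T|\tilde f|^2\sum_{j}\Big[ik_jG_{j2}-\frac{\sigma_j^2+V_j^2}{2}k_j^2\Big]dt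 .$$ **Statement.** (1) Almost surely, for all test functions $k_1,k_2$, $$\Phi_T^Z[\vec k;f]=\exp\sum_{j=1}^2\int_0^T dt\,\Big\{ik_j(t)\Big[G_{j2}|\tilde f(t)|^2+\big(ie^{i\psi_j}\overline{f_s(t)}\tilde f(t)+\text{c.c.}\big)\Big]-\frac{\kappa_{j2}}{2\kappa_{j3}^{2}}k_j(t)^2|\tilde f(t)|^2\Big\}.$$ (2) The $N_j$ form a mixture of Poisson processes: a.s., for all test functions $k_1,\dots,k_4$ and all $L>0$, $$\mathbb E\Big[\exp\Big\{i\sum_{j=1}^4\int_0^Tk_j\,dN_j\Big\}\,\Big|\,f_s,\tilde f\Big]=\exp\sum_{j=1}^4\int_0^T\big(e^{ik_j(t)}-1\big)J_j(t)\,dt,\qquad J_j=\big|\sqrt{g_{j1}}f_s+s_j\,ie^{i\psi_j}\sqrt{g_{j2}}\,f\big|^2,$$ where $s_1=s_2=1$, $s_3=s_4=-1$, $\psi_{j+2}=\psi_j$, $g_{11}=\eta_1\eta_3\epsilon_1$, $g_{21}=(1-\eta_1)\eta_4\epsilon_2$, $g_{31}=\eta_1(1-\eta_3)\epsilon_3$,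 $g_{41}=(1-\eta_1)(1-\eta_4)\epsilon_4$, $g_{12}=\eta_2(1-\eta_3)\epsilon_1$, $g_{22}=(1-\eta_2)(1-\eta_4)\epsilon_2$, $g_{32}=\eta_2\eta_3\epsilon_3$, $g_{42}=(1-\eta_2)\eta_4\epsilon_4$. (3) Let the circuit parameters depend on $L$, converge as $L\to+\infty$ to the given ones, and satisfy $\Delta_{j2}(L)\,L/\kappa_{j3}(L)=G_{j2}$ for $j=1,2$ and all large $L$. Then, a.s., for all test functions $k_1,k_2$, $$\lim_{L\to+\infty}\mathbb E\Big[\exp\Big\{i\sum_{j=1}^2\int_0^Tk_j\,dZ_j\Big\}\,\Big|\,f_s,\tilde f\Big]=\Phi^Z_T[\vec k;f];$$ and for all test functions $k_1,k_2$, with $k_j^T(t)=\kappa_{j3}\int_t^Th(s-t)k_j(s)\,ds$ ($\kappa_{j3}$ being the limiting value), $$\lim_{L\to+\infty}\mathbb E_P\Big[\exp\Big\{\frac iL\sum_{j=1}^2\int_0^Tk_j(s)X_j(s)\,ds\Big\}\Big]=\mathbb E_f\big[\Phi^Z_T[\vec k^T;f]\big],$$ where $\mathbb E_P$ is the expectation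 for the total (mixed) state; the random variables $\Phi^Z_T[\vec k^T;f]$ and, for each $L>0$, the conditional expectation of $\exp\{\frac iL\sum_j\int_0^Tk_jX_j\,ds\}$ given $(f_s,\tilde f)$ are integrable. -/

import Mathlib

open MeasureTheory Filter Topology Complex Set
open scoped ENNReal ComplexConjugate

noncomputable section
namespace Homodyne

section Extension

variable {ι H : Type*} [NormedAddCommGroup H] [InnerProductSpace ℂ H]

/-- The closed linear span of a family of vectors. -/
def closedSpan (e : ι → H) : Submodule ℂ H := (Submodule.span ℂ (range e)).topologicalClosure

instance [CompleteSpace H] (e : ι → H) : CompleteSpace (closedSpan e) :=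
  (Submodule.isClosed_topologicalClosure _).completeSpace_coe

theorem mem_closedSpan (e : ι → H) (i : ι) : e i ∈ closedSpan e :=
  Submodule.le_topologicalClosure _ (Submodule.subset_span (mem_range_self i))

/-- Formal linear combinations of a family, evaluated in its closed linear span. -/
def spanMap (e : ι → H) : (ι →₀ ℂ) →ₗ[ℂ] closedSpan e :=
  Finsupp.linearCombination ℂ fun i => ⟨e i, mem_closedSpan e i⟩

/-- The continuous linear operator with `e i ↦ e' i`, for families with the same Gram matrix:
extended by linearity and continuity to the closed linear span of the `e i`, and by `0` to the
orthogonal complement of that span. -/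
def extendFamily [CompleteSpace H] (e e' : ι → H) : H →L[ℂ] H :=
  ((Finsupp.linearCombination ℂ e').extendOfNorm (spanMap e)) ∘L
    (closedSpan e).orthogonalProjectionOnto

theorem denseRange_spanMap (e : ι → H) : DenseRange (spanMap e) := by
  rintro ⟨x, hx⟩
  rw [closure_subtype]
  refine closure_mono ?_ hx
  intro y hy
  obtain ⟨c, hc⟩ := (Finsupp.mem_span_range_iff_exists_finsupp).1 hy
  refine ⟨spanMap e c, mem_range_self c, ?_⟩
  rw [← hc, spanMap, Finsupp.linearCombination_apply, Finsupp.sum, Finsupp.sum,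
    AddSubmonoidClass.coe_finsetSum]
  rfl

theorem extendFamily_apply [CompleteSpace H] (e e' : ι → H)
    (h : ∀ i j, inner ℂ (e' i) (e' j) = inner ℂ (e i) (e j)) (i : ι) :
    extendFamily e e' (e i) = e' i := by
  have hn : ∀ c : ι →₀ ℂ, ‖Finsupp.linearCombination ℂ e' c‖ = ‖spanMap e c‖ := by
    intro c
    have h : inner ℂ (Finsupp.linearCombination ℂ e' c) (Finsupp.linearCombination ℂ e' c)
        = inner ℂ (spanMap e c) (spanMap e c) := by
      simp only [spanMap, Finsupp.linearCombination_apply, Finsupp.sum, sum_inner, inner_sum]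
      refine Finset.sum_congr rfl fun u _ => Finset.sum_congr rfl fun v _ => ?_
      rw [inner_smul_left, inner_smul_right, h, inner_smul_left, inner_smul_right]
      rfl
    rw [inner_self_eq_norm_sq_to_K, inner_self_eq_norm_sq_to_K] at h
    have h' : ‖Finsupp.linearCombination ℂ e' c‖ ^ 2 = ‖spanMap e c‖ ^ 2 := by exact_mod_cast h
    exact (pow_left_inj₀ (norm_nonneg _) (norm_nonneg _) two_ne_zero).1 h'
  have h1 : spanMap e (Finsupp.single i 1) = ⟨e i, mem_closedSpan e i⟩ := by simp [spanMap]
  have h2 := LinearMap.extendOfNorm_eq (f := Finsupp.linearCombination ℂ e') (e := spanMap e)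
    (denseRange_spanMap e) ⟨1, fun c => by rw [one_mul, hn]⟩ (Finsupp.single i 1)
  have h3 : (closedSpan e).orthogonalProjectionOnto (e i) = ⟨e i, mem_closedSpan e i⟩ :=
    Submodule.orthogonalProjectionOnto_mem_subspace_eq_self ⟨e i, mem_closedSpan e i⟩
  rw [extendFamily, ContinuousLinearMap.comp_apply, h3, ← h1, h2]
  simp

end Extension

section Fock

variable {X : Type*} [MeasurableSpace X] (μ : Measure X) [SigmaFinite μ]

/-- The `n`-fold tensor power of `L²(X, μ)`, realized as `L²(Xⁿ, μⁿ)`. -/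
abbrev NPart (n : ℕ) : Type _ := Lp ℂ 2 (Measure.pi fun _ : Fin n => μ)

/-- The full Fock space `⊕ₙ L²(Xⁿ, μⁿ)` (Hilbert direct sum). -/
abbrev FullFock : Type _ := lp (fun n : ℕ => NPart μ n) 2

theorem measurePreserving_perm {n : ℕ} (σ : Equiv.Perm (Fin n)) :
    MeasurePreserving (fun x : Fin n → X => x ∘ σ)
      (Measure.pi fun _ : Fin n => μ) (Measure.pi fun _ : Fin n => μ) := by
  convert measurePreserving_piCongrLeft (fun _ : Fin n => μ) σ⁻¹ using 1
  ext x i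
  have := Equiv.piCongrLeft_apply (P := fun _ : Fin n => X) (e := σ⁻¹) x i
  rw [MeasurableEquiv.coe_piCongrLeft, this]
  simp only [Function.comp_apply, eq_rec_constant]
  rfl

/-- The symmetric Fock space over `L²(X, μ)`: sequences of square-integrable wave functions, the
`n`-th one being invariant under permutations of its `n` arguments. -/
def symmFock : Submodule ℂ (FullFock μ) where
  carrier := {ψ | ∀ (n : ℕ) (σ : Equiv.Perm (Fin n)),
    Lp.compMeasurePreservingₗᵢ ℂ _ (measurePreserving_perm μ σ) (ψ n) = ψ n}
  add_mem' := fun {a b} ha hb n σ => by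
    rw [lp.coeFn_add, Pi.add_apply, map_add, ha n σ, hb n σ]
  zero_mem' := fun n σ => by
    rw [lp.coeFn_zero, Pi.zero_apply, map_zero]
  smul_mem' := fun c a ha n σ => by
    rw [lp.coeFn_smul, Pi.smul_apply, map_smul, ha n σ]


theorem isClosed_symmFock : IsClosed (symmFock μ : Set (FullFock μ)) := by
  have : (symmFock μ : Set (FullFock μ)) = ⋂ (n : ℕ) (σ : Equiv.Perm (Fin n)),
      {ψ | Lp.compMeasurePreservingₗᵢ ℂ _ (measurePreserving_perm μ σ)
        (lp.evalCLM ℂ (fun n : ℕ => NPart μ n) 2 n ψ) = lp.evalCLM ℂ (fun n : ℕ => NPart μ n) 2 n ψ} := by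
    ext ψ; simp only [mem_iInter]; rfl
  rw [this]
  refine isClosed_iInter fun n => isClosed_iInter fun σ => isClosed_eq ?_ ?_
  · exact (LinearIsometry.continuous _).comp (ContinuousLinearMap.continuous _)
  · exact ContinuousLinearMap.continuous _

/-- The symmetric Fock space as a Hilbert space. -/
def Fock : Type _ := symmFock μ

instance : NormedAddCommGroup (Fock μ) := inferInstanceAs (NormedAddCommGroup (symmFock μ))

instance : InnerProductSpace ℂ (Fock μ) := inferInstanceAs (InnerProductSpace ℂ (symmFock μ))

instance : CompleteSpace (Fock μ) := (isClosed_symmFock μ).completeSpace_coe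

variable {μ}

theorem ae_eval_comp {n : ℕ} {u v : X → ℂ} (h : u =ᵐ[μ] v) :
    (fun x : Fin n → X => ∏ i, u (x i)) =ᵐ[Measure.pi fun _ : Fin n => μ]
      fun x => ∏ i, v (x i) := by
  have : ∀ i : Fin n, ∀ᵐ x ∂(Measure.pi fun _ : Fin n => μ), u (x i) = v (x i) := fun i =>
    (Measure.quasiMeasurePreserving_eval (fun _ : Fin n => μ) i).ae h
  filter_upwards [ae_all_iff.2 this] with x hx
  exact Finset.prod_congr rfl fun i _ => hx i

theorem memLp_prod (n : ℕ) (u : Lp ℂ 2 μ) :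
    MemLp (fun x : Fin n → X => ∏ i, u (x i)) 2 (Measure.pi fun _ : Fin n => μ) := by
  rw [memLp_two_iff_integrable_sq_norm]
  · have h := (memLp_two_iff_integrable_sq_norm (Lp.aestronglyMeasurable u)).1 (Lp.memLp u)
    have := Integrable.fintype_prod (ι := Fin n) (f := fun _ x => ‖u x‖ ^ 2) (fun _ => h)
    simpa [norm_prod, Finset.prod_pow] using this
  · refine Finset.aestronglyMeasurable_fun_prod _ fun i _ => ?_
    exact (Lp.aestronglyMeasurable u).comp_quasiMeasurePreserving
      (Measure.quasiMeasurePreserving_eval (fun _ : Fin n => μ) i)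

/-- The tensor power `u ⊗ ⋯ ⊗ u` (`n` factors), i.e. `(x₁, …, xₙ) ↦ u x₁ ⋯ u xₙ`. -/
def tpow (n : ℕ) (u : Lp ℂ 2 μ) : NPart μ n := (memLp_prod n u).toLp _

theorem inner_tpow (n : ℕ) (u v : Lp ℂ 2 μ) :
    inner ℂ (tpow n u) (tpow n v) = inner ℂ u v ^ n := by
  have h : (fun x : Fin n → X => inner ℂ (tpow n u x) (tpow n v x))
      =ᵐ[Measure.pi fun _ : Fin n => μ] fun x => ∏ i, inner ℂ (u (x i)) (v (x i)) := by
    filter_upwards [(memLp_prod n u).coeFn_toLp, (memLp_prod n v).coeFn_toLp] with x h1 h2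
    simp only [tpow, h1, h2]
    simp [Finset.prod_mul_distrib, map_prod]
  rw [L2.inner_def, integral_congr_ae h, L2.inner_def,
    integral_fintype_prod_eq_pow (fun x => inner ℂ (u x) (v x)), Fintype.card_fin]

theorem norm_tpow (n : ℕ) (u : Lp ℂ 2 μ) : ‖tpow n u‖ = ‖u‖ ^ n := by
  have h := inner_tpow n u u
  rw [inner_self_eq_norm_sq_to_K, inner_self_eq_norm_sq_to_K] at h
  have h' : ‖tpow n u‖ ^ 2 = (‖u‖ ^ n) ^ 2 := by
    rw [← pow_mul, mul_comm, pow_mul]; exact_mod_cast h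
  exact (pow_left_inj₀ (norm_nonneg _) (by positivity) two_ne_zero).1 h'

theorem memlp_expVec (u : Lp ℂ 2 μ) :
    Memℓp (fun n : ℕ => ((√(n.factorial : ℝ) : ℝ) : ℂ)⁻¹ • tpow n u) 2 := by
  refine memℓp_gen ?_
  have := Real.summable_pow_div_factorial (‖u‖ ^ 2)
  refine this.congr fun n => ?_
  rw [norm_smul, norm_tpow, norm_inv, Complex.norm_real, Real.norm_of_nonneg (Real.sqrt_nonneg _)]
  simp only [ENNReal.toReal_ofNat]
  rw [Real.rpow_two, mul_pow, inv_pow, Real.sq_sqrt (by positivity)]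
  rw [← pow_mul, ← pow_mul, mul_comm 2 n]; field_simp

/-- The exponential vector `E(u) = (1, u, u ⊗ u / √2!, …, u^{⊗ n} / √n!, …)`. -/
def expVec (u : Lp ℂ 2 μ) : Fock μ :=
  ⟨⟨_, memlp_expVec u⟩, fun n σ => by
    change Lp.compMeasurePreservingₗᵢ ℂ _ (measurePreserving_perm μ σ)
      (((√(n.factorial : ℝ) : ℝ) : ℂ)⁻¹ • tpow n u) = ((√(n.factorial : ℝ) : ℝ) : ℂ)⁻¹ • tpow n u
    rw [map_smul]
    congr 1
    refine Lp.ext ?_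
    refine (Lp.coeFn_compMeasurePreserving _ (measurePreserving_perm μ σ)).trans ?_
    have h1 := (memLp_prod n u).coeFn_toLp
    refine ((measurePreserving_perm μ σ).quasiMeasurePreserving.ae_eq_comp h1).trans ?_
    refine EventuallyEq.trans (Eventually.of_forall fun x => ?_) h1.symm
    exact Equiv.prod_comp σ (fun i => u (x i))⟩

theorem inner_expVec (u v : Lp ℂ 2 μ) :
    inner ℂ (expVec u) (expVec v) = Complex.exp (inner ℂ u v) := by
  change inner ℂ (expVec u).1 (expVec v).1 = _
  rw [lp.inner_eq_tsum, Complex.exp_eq_exp_ℂ,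
    NormedSpace.exp_eq_tsum_div]
  refine tsum_congr fun n => ?_
  change inner ℂ (((√(n.factorial : ℝ) : ℝ) : ℂ)⁻¹ • tpow n u)
    (((√(n.factorial : ℝ) : ℝ) : ℂ)⁻¹ • tpow n v) = _
  have h : ((√(n.factorial : ℝ) : ℝ) : ℂ) * ((√(n.factorial : ℝ) : ℝ) : ℂ) = (n.factorial : ℂ) := by
    rw [← Complex.ofReal_mul, Real.mul_self_sqrt (by positivity)]; simp
  rw [inner_smul_left, inner_smul_right, inner_tpow, map_inv₀, Complex.conj_ofReal, ← mul_assoc,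
    ← mul_inv, h, div_eq_inv_mul]

/-- The coherent vector `e(u) = exp(-‖u‖² / 2) E(u)`. -/
def cohVec (u : Lp ℂ 2 μ) : Fock μ := (Real.exp (-(‖u‖ ^ 2) / 2) : ℂ) • expVec u

/-- The Weyl operator `W(g) = exp(∫ (g dA† - ḡ dA))`: the continuous linear operator given on the
exponential vectors by `W(g) E(u) = exp(-‖g‖² / 2 - ⟪g, u⟫) E(u + g)`, and extended by linearity and
continuity (the exponential vectors are total in the symmetric Fock space). -/
def weyl (g : Lp ℂ 2 μ) : Fock μ →L[ℂ] Fock μ :=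
  extendFamily expVec fun u =>
    Complex.exp (-((‖g‖ : ℂ) ^ 2) / 2 - inner ℂ g u) • expVec (u + g)

theorem weyl_expVec (g u : Lp ℂ 2 μ) :
    weyl g (expVec u) = Complex.exp (-((‖g‖ : ℂ) ^ 2) / 2 - inner ℂ g u) • expVec (u + g) := by
  refine extendFamily_apply _ _ (fun u v => ?_) u
  have hn : inner ℂ g g = (‖g‖ : ℂ) ^ 2 := inner_self_eq_norm_sq_to_K g
  rw [inner_smul_left, inner_smul_right, inner_expVec, inner_expVec, ← Complex.exp_conj,
    ← Complex.exp_add, ← Complex.exp_add]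
  congr 1
  simp only [inner_add_left, inner_add_right, map_sub, map_div₀, map_neg, map_pow,
    Complex.conj_ofReal, hn, inner_conj_symm, Complex.conj_ofNat]
  ring

/-- The Weyl operators `W(t g)`, `t ∈ ℝ`, satisfy the group law on the exponential vectors. -/
theorem weyl_smul_add (g u : Lp ℂ 2 μ) (s t : ℝ) :
    weyl ((s : ℂ) • g) (weyl ((t : ℂ) • g) (expVec u)) = weyl (((s + t : ℝ) : ℂ) • g) (expVec u) := by
  have hn : inner ℂ g g = (‖g‖ : ℂ) ^ 2 := inner_self_eq_norm_sq_to_K g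
  have hs : ∀ r : ℝ, ((‖(r : ℂ) • g‖ : ℝ) : ℂ) ^ 2 = r ^ 2 * (‖g‖ : ℂ) ^ 2 := fun r => by
    rw [norm_smul, Complex.norm_real, Complex.ofReal_mul, mul_pow]
    congr 1
    exact_mod_cast sq_abs r
  rw [weyl_expVec, map_smul, weyl_expVec, weyl_expVec, smul_smul, ← Complex.exp_add]
  congr 1
  · congr 1
    simp only [hs, inner_smul_left, inner_smul_right, inner_add_right, hn, Complex.conj_ofReal]
    push_cast
    ring
  · rw [add_assoc, ← add_smul]
    push_cast
    rw [add_comm (s : ℂ) (t : ℂ)]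

/-- The generator of `t ↦ W(t g)` is `∫ (g dA† - ḡ dA)`: on the exponential vectors, `∫ ḡ dA` has
the eigenvalue `⟪g, u⟫` at `E(u)`, and `∫ g dA†` is its adjoint. -/
theorem hasDerivAt_weyl (g u v : Lp ℂ 2 μ) :
    HasDerivAt (fun t : ℝ => inner ℂ (expVec v) (weyl ((t : ℂ) • g) (expVec u)))
      ((inner ℂ v g - inner ℂ g u) * inner ℂ (expVec v) (expVec u)) 0 := by
  have hs : ∀ r : ℝ, ((‖(r : ℂ) • g‖ : ℝ) : ℂ) ^ 2 = r ^ 2 * (‖g‖ : ℂ) ^ 2 := fun r => by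
    rw [norm_smul, Complex.norm_real, Complex.ofReal_mul, mul_pow]
    congr 1
    exact_mod_cast sq_abs r
  have h : (fun t : ℝ => inner ℂ (expVec v) (weyl ((t : ℂ) • g) (expVec u))) = fun t : ℝ =>
      Complex.exp (-((t : ℂ) ^ 2 * (‖g‖ : ℂ) ^ 2) / 2 - t * inner ℂ g u
        + (inner ℂ v u + t * inner ℂ v g)) := by
    funext t
    rw [weyl_expVec, inner_smul_right, inner_expVec, ← Complex.exp_add, hs, inner_smul_left,
      inner_add_right, inner_smul_right, Complex.conj_ofReal]
  rw [h]
  have h0 : HasDerivAt (fun t : ℝ => (t : ℂ)) 1 0 := (hasDerivAt_id (0 : ℝ)).ofReal_comp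
  have h1 := ((((h0.pow 2).mul_const ((‖g‖ : ℂ) ^ 2)).neg.div_const 2).sub
    (h0.mul_const (inner ℂ g u))).add ((h0.mul_const (inner ℂ v g)).const_add (inner ℂ v u))
  refine h1.cexp.congr_deriv ?_
  rw [inner_expVec]
  simp
  ring

/-- The trace of an operator on the Fock space, computed in a Hilbert basis. -/
def fockTrace (B : Fock μ →L[ℂ] Fock μ) : ℂ :=
  ∑' i, inner ℂ ((exists_hilbertBasis ℂ (Fock μ)).choose_spec.choose i)
    (B ((exists_hilbertBasis ℂ (Fock μ)).choose_spec.choose i))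

/-- The pure state `|ψ⟩⟨ψ|`. -/
def pureState (ψ : Fock μ) : Fock μ →L[ℂ] Fock μ := InnerProductSpace.rankOne ℂ ψ ψ

/-- The `n`-particle wave function of a Fock vector. -/
def wave (ψ : Fock μ) (n : ℕ) : (Fin n → X) → ℂ :=
  ((show symmFock μ from ψ) : FullFock μ) n

variable (μ) in
open Classical in
/-- The class in `L²(X, μ)` of a square-integrable function (and `0` for any other function). -/
def toL2 (u : X → ℂ) : Lp ℂ 2 μ := if h : MemLp u 2 μ then h.toLp u else 0

end Fock

/-! ### The optical circuit -/

/-- The parameters of the circuit (the indices `1, 2, 3, 4` are written `0, 1, 2, 3`):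
transmissivities `η j` of the four beam splitters, efficiencies `ε j` and conversion factors `ξ j`
of the four detectors, and the two tunable phases `ψ j`. -/
structure Circuit where
  η : Fin 4 → ℝ
  ε : Fin 4 → ℝ
  ξ : Fin 4 → ℝ
  ψ : Fin 2 → ℝ
  η_pos : ∀ j, 0 < η j
  η_lt_one : ∀ j, η j < 1
  ε_pos : ∀ j, 0 < ε j
  ε_le_one : ∀ j, ε j ≤ 1
  ξ_pos : ∀ j, 0 < ξ j

namespace Circuit

variable (p : Circuit)

/-- `√η_j` as a complex number. -/
def tr (j : Fin 4) : ℂ := (√(p.η j) : ℝ)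

/-- `i √(1 - η_j)`. -/
def rf (j : Fin 4) : ℂ := I * (√(1 - p.η j) : ℝ)

/-- The phase factor `exp(i ψ_j)`. -/
def ph (j : Fin 2) : ℂ := Complex.exp (I * (p.ψ j : ℝ))

/-- First stage, `(A₁, …, A₄) ↦ (B₁, …, B₄)`: beam splitter 1 mixes the signal `A₁` with `A₂`, beam
splitter 2 mixes the local oscillator `A₃` with `A₄` and is followed by the phase shifts. -/
def stageB : Matrix (Fin 4) (Fin 4) ℂ :=
  !![p.tr 0, p.rf 0, 0, 0;
     p.rf 0, p.tr 0, 0, 0;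
     0, 0, p.ph 0 * p.tr 1, p.ph 0 * p.rf 1;
     0, 0, p.ph 1 * p.rf 1, p.ph 1 * p.tr 1]

/-- Second stage, `(B₁, …, B₄) ↦ (C₁, …, C₄)`: beam splitter 3 mixes `B₁` with `B₃`, beam splitter 4
mixes `B₂` with `B₄`. -/
def stageC : Matrix (Fin 4) (Fin 4) ℂ :=
  !![p.tr 2, 0, p.rf 2, 0;
     0, p.tr 3, 0, p.rf 3;
     p.rf 2, 0, p.tr 2, 0;
     0, p.rf 3, 0, p.tr 3]

/-- Last stage, `(C_j, A_{j+}) ↦ (D_j, D_{j+})`: the fictitious beam splitters of transmissivity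
`ε_j` that model losses and detector efficiencies. -/
def stageD : Matrix (Fin 4 ⊕ Fin 4) (Fin 4 ⊕ Fin 4) ℂ :=
  Matrix.fromBlocks
    (Matrix.diagonal fun j => ((√(p.ε j) : ℝ) : ℂ))
    (Matrix.diagonal fun j => I * (√(1 - p.ε j) : ℝ))
    (Matrix.diagonal fun j => I * (√(1 - p.ε j) : ℝ))
    (Matrix.diagonal fun j => ((√(p.ε j) : ℝ) : ℂ))

/-- The unitary matrix of the whole circuit, from the input fields `A₁, …, A₄, A_{1+}, …, A_{4+}`
(ports `0, …, 7`) to the output fields `D₁, …, D₄, D_{1+}, …, D_{4+}` (ports `0, …, 7`). -/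
def scattering : Matrix (Fin 8) (Fin 8) ℂ :=
  Matrix.reindex finSumFinEquiv finSumFinEquiv
    (p.stageD * Matrix.fromBlocks (p.stageC * p.stageB) 0 0 1)

/-- `κ_{j2}`, `j = 1, 2`. -/
def κ₂ : Fin 2 → ℝ :=
  ![p.η 1 * ((1 - p.η 2) * p.ε 0 * p.ξ 0 ^ 2 + p.η 2 * p.ε 2 * p.ξ 2 ^ 2),
    (1 - p.η 1) * ((1 - p.η 3) * p.ε 1 * p.ξ 1 ^ 2 + p.η 3 * p.ε 3 * p.ξ 3 ^ 2)]

/-- `κ_{j3}`, `j = 1, 2`. -/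
def κ₃ : Fin 2 → ℝ :=
  ![√(p.η 0 * p.η 1 * p.η 2 * (1 - p.η 2)) * (p.ε 0 * p.ξ 0 + p.ε 2 * p.ξ 2),
    √((1 - p.η 0) * (1 - p.η 1) * p.η 3 * (1 - p.η 3)) * (p.ε 1 * p.ξ 1 + p.ε 3 * p.ξ 3)]

/-- `Δ_{j2}`, `j = 1, 2`. -/
def Δ₂ : Fin 2 → ℝ :=
  ![p.η 1 * ((1 - p.η 2) * p.ε 0 * p.ξ 0 - p.η 2 * p.ε 2 * p.ξ 2),
    (1 - p.η 1) * ((1 - p.η 3) * p.ε 1 * p.ξ 1 - p.η 3 * p.ε 3 * p.ξ 3)]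

/-- `g_{j1}`, `j = 1, …, 4`. -/
def g₁ : Fin 4 → ℝ :=
  ![p.η 0 * p.η 2 * p.ε 0, (1 - p.η 0) * p.η 3 * p.ε 1,
    p.η 0 * (1 - p.η 2) * p.ε 2, (1 - p.η 0) * (1 - p.η 3) * p.ε 3]

/-- `g_{j2}`, `j = 1, …, 4`. -/
def g₂ : Fin 4 → ℝ :=
  ![p.η 1 * (1 - p.η 2) * p.ε 0, (1 - p.η 1) * (1 - p.η 3) * p.ε 1,
    p.η 1 * p.η 2 * p.ε 2, (1 - p.η 1) * p.η 3 * p.ε 3]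

/-- `G_{13} = (1 - η₁) / η₁` and `G_{23} = η₁ / (1 - η₁)`. -/
def G₃ : Fin 2 → ℝ := ![(1 - p.η 0) / p.η 0, p.η 0 / (1 - p.η 0)]

/-- `V_1²` and `V_2²`. -/
def Vsq : Fin 2 → ℝ :=
  ![p.Δ₂ 0 ^ 2 / (p.η 1 * p.κ₃ 0 ^ 2), p.Δ₂ 1 ^ 2 / ((1 - p.η 1) * p.κ₃ 1 ^ 2)]

/-- `σ_1²` and `σ_2²`. -/
def σsq : Fin 2 → ℝ :=
  ![((p.ε 0 * (1 - p.ε 0) / p.η 2 * p.ξ 0 ^ 2 + p.ε 2 * (1 - p.ε 2) / (1 - p.η 2) * p.ξ 2 ^ 2)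
        / (p.ε 0 * p.ξ 0 + p.ε 2 * p.ξ 2) ^ 2) / p.η 0,
    ((p.ε 1 * (1 - p.ε 1) / p.η 3 * p.ξ 1 ^ 2 + p.ε 3 * (1 - p.ε 3) / (1 - p.η 3) * p.ξ 3 ^ 2)
        / (p.ε 1 * p.ξ 1 + p.ε 3 * p.ξ 3) ^ 2) / (1 - p.η 0)]

/-- The matrix `Ξ`, with off-diagonal entries `-cos (ψ₂ - ψ₁)`. -/
def Ξ : Matrix (Fin 2) (Fin 2) ℝ :=
  !![p.G₃ 0, -Real.cos (p.ψ 1 - p.ψ 0); -Real.cos (p.ψ 1 - p.ψ 0), p.G₃ 1]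

end Circuit

/-- The detector `j` of the balanced pair `(j, j + 2)`, `j = 1, 2`. -/
def plusDet : Fin 2 → Fin 4 := ![0, 1]

/-- The detector `j + 2` of the balanced pair `(j, j + 2)`, whose output is subtracted. -/
def minusDet : Fin 2 → Fin 4 := ![2, 3]

/-- The index in `{1, 2}` of the phase seen by the detector `j`: `ψ_{j+2} = ψ_j`. -/
def phaseIdx : Fin 4 → Fin 2 := ![0, 1, 0, 1]

/-- The signs `s_1 = s_2 = 1`, `s_3 = s_4 = -1`. -/
def detSign : Fin 4 → ℝ := ![1, 1, -1, -1]

/-! ### The field state and the law of the photon counts -/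

/-- Restriction of a wave to the time interval `(0, T)`. -/
def window (T : ℝ) (u : ℝ → ℂ) : ℝ → ℂ := (Ioo 0 T).indicator u

/-- The measure on (port, time); the Fock space over it is the Hilbert space of the eight fields
(it is the tensor product of the Fock spaces `Γ_j` of the single fields, and the coherent vector of
`(u₁, u₂, …)` is the tensor product of the coherent vectors of the `u_j`). -/
abbrev portMeasure : Measure (Fin 8 × ℝ) := (Measure.count : Measure (Fin 8)).prod volume

/-- The amplitude with signal `u` in `A₁` and local oscillator `v` in `A₃`, in the time interval
`(0, T)`; all the other fields are in the vacuum. -/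
def inputAmp (T : ℝ) (u v : ℝ → ℂ) : Fin 8 × ℝ → ℂ := fun y =>
  if y.1 = 0 then window T u y.2 else if y.1 = 2 then window T v y.2 else 0

/-- The vector of the state of the eight input fields. -/
def inputVec (T : ℝ) (u v : ℝ → ℂ) : Fock portMeasure :=
  cohVec (toL2 portMeasure (inputAmp T u v))

/-- The `n`-photon wave function, in terms of the output fields, of a state of the input fields: the
second quantization of the scattering matrix `S`, acting as `S ⊗ ⋯ ⊗ S` on the ports. -/
def outputWave (S : Matrix (Fin 8) (Fin 8) ℂ) (Ψ : Fock portMeasure) (n : ℕ)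
    (x : Fin n → Fin 8 × ℝ) : ℂ :=
  ∑ i : Fin n → Fin 8, (∏ l, S (x l).1 (i l)) * wave Ψ n fun l => (i l, (x l).2)

/-- A configuration of photons at the output: their number `n`, and the port and the arrival time of
each of them. -/
abbrev Config : Type := Σ n : ℕ, (Fin n → Fin 8 × ℝ)

/-- The law of the photon configuration at the output when the input state is `Ψ`. The number
operators of the output fields are, in the `n`-photon space of the output fields, the multiplication
operators by the numbers of photons in a port and a time interval; so their joint projection valued
measure consists of multiplications by indicator functions and it yields the density `|Ψ_n|²`. -/
def photonLaw (S : Matrix (Fin 8) (Fin 8) ℂ) (Ψ : Fock portMeasure) : Measure Config :=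
  Measure.sum fun n =>
    ((Measure.pi fun _ : Fin n => portMeasure).withDensity fun x =>
      ENNReal.ofReal (‖outputWave S Ψ n x‖ ^ 2)).map (Sigma.mk n)

/-- The counting measure `dN_j` of the detector `j`, so that `N_j(t)` is its value on `(0, t]`. -/
def counts (j : Fin 4) (c : Config) : Measure ℝ :=
  ∑ l : Fin c.1, if (c.2 l).1 = Fin.castAdd 4 j then Measure.dirac (c.2 l).2 else 0

/-- The output `X_j(t) = ξ_j ∫_{(0,t]} h(t-s) dN_j(s) - ξ_{j+2} ∫_{(0,t]} h(t-s) dN_{j+2}(s)`. -/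
def outputX (p : Circuit) (h : ℝ → ℝ) (j : Fin 2) (c : Config) (t : ℝ) : ℝ :=
  p.ξ (plusDet j) * (∫ s in Ioc 0 t, h (t - s) ∂counts (plusDet j) c)
    - p.ξ (minusDet j) * ∫ s in Ioc 0 t, h (t - s) ∂counts (minusDet j) c

/-- `∫_0^T k dZ_j`, where `Z_j = (ξ_j N_j - ξ_{j+2} N_{j+2}) / (L κ_{j3})`. -/
def intZ (p : Circuit) (T L : ℝ) (j : Fin 2) (k : ℝ → ℝ) (c : Config) : ℝ :=
  (p.ξ (plusDet j) * (∫ s in Ioo 0 T, k s ∂counts (plusDet j) c)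
    - p.ξ (minusDet j) * ∫ s in Ioo 0 T, k s ∂counts (minusDet j) c) / (L * p.κ₃ j)

/-- Conditional characteristic functional of the counts, for given signal amplitude `u` and local
oscillator amplitude `v`. -/
def condPhiN (p : Circuit) (T : ℝ) (k : Fin 4 → ℝ → ℝ) (u v : ℝ → ℂ) : ℂ :=
  ∫ c, Complex.exp (I * ((∑ j, ∫ s in Ioo 0 T, k j s ∂counts j c : ℝ) : ℂ))
    ∂photonLaw p.scattering (inputVec T u v)

/-- Conditional characteristic functional of the increments of `Z_1, Z_2`, for given signal amplitude
`u` and local oscillator amplitude `L v`. -/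
def condPhiZ (p : Circuit) (T L : ℝ) (k : Fin 2 → ℝ → ℝ) (u v : ℝ → ℂ) : ℂ :=
  ∫ c, Complex.exp (I * ((∑ j, intZ p T L j (k j) c : ℝ) : ℂ))
    ∂photonLaw p.scattering (inputVec T u fun t => L * v t)

/-- Conditional characteristic functional of `Y_j = X_j / L`, for given signal amplitude `u` and
local oscillator amplitude `L v`. -/
def condPhiY (p : Circuit) (h : ℝ → ℝ) (T L : ℝ) (k : Fin 2 → ℝ → ℝ) (u v : ℝ → ℂ) : ℂ :=
  ∫ c, Complex.exp (I / L * ((∑ j, ∫ t in Ioo 0 T, k j t * outputX p h j c t : ℝ) : ℂ))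
    ∂photonLaw p.scattering (inputVec T u fun t => L * v t)

/-- The intensity `J_j(t) = |√g_{j1} u(t) + s_j i exp(i ψ_j) √g_{j2} v(t)|²`. -/
def intensity (p : Circuit) (j : Fin 4) (u v : ℝ → ℂ) (t : ℝ) : ℝ :=
  ‖(√(p.g₁ j) : ℝ) * u t + detSign j * I * p.ph (phaseIdx j) * (√(p.g₂ j) : ℝ) * v t‖ ^ 2

/-! ### The limiting conditional characteristic functional -/

/-- The characteristic operator
`exp ∫_0^T {i ∑_j k_j dQ_j - ½ ∑_{i,j} k_j Ξ_{ji} k_i |v|² dt}` on the signal Fock space, where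
`dQ_j = i exp(i ψ_j) v dA₁† + h.c.`; here `i ∑_j k_j dQ_j = g dA₁† - ḡ dA₁` with
`g = ∑_j i k_j i exp(i ψ_j) v`. -/
def psiQ (p : Circuit) (T : ℝ) (k : Fin 2 → ℝ → ℝ) (v : ℝ → ℂ) :
    Fock (volume : Measure ℝ) →L[ℂ] Fock (volume : Measure ℝ) :=
  (Real.exp (∫ t in Ioo 0 T, -(1 / 2) * (∑ j, ∑ i, k j t * p.Ξ j i * k i t) * ‖v t‖ ^ 2) : ℂ) •
    weyl (toL2 volume (window T fun t => ∑ j, I * k j t * (I * p.ph j * v t)))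

/-- `Φ^Q`: the expectation of the characteristic operator in the coherent signal state. -/
def phiQ (p : Circuit) (T : ℝ) (k : Fin 2 → ℝ → ℝ) (u v : ℝ → ℂ) : ℂ :=
  fockTrace (psiQ p T k v ∘L pureState (cohVec (toL2 volume (window T u))))

/-- The Gaussian factor `Γ`. -/
def gammaT (p : Circuit) (G : Fin 2 → ℝ) (T : ℝ) (k : Fin 2 → ℝ → ℝ) (v : ℝ → ℂ) : ℂ :=
  Complex.exp (∫ t in Ioo 0 T, (‖v t‖ ^ 2 : ℝ) *
    ∑ j, (I * k j t * G j - ((p.σsq j + p.Vsq j) / 2 * k j t ^ 2 : ℝ)))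

/-- `Φ^Z = Φ^Q Γ`. -/
def phiZ (p : Circuit) (G : Fin 2 → ℝ) (T : ℝ) (k : Fin 2 → ℝ → ℝ) (u v : ℝ → ℂ) : ℂ :=
  phiQ p T k u v * gammaT p G T k v

/-- The smoothed test functions `k_j^T(t) = κ_{j3} ∫_t^T h(s-t) k_j(s) ds`. -/
def smoothed (p : Circuit) (h : ℝ → ℝ) (T : ℝ) (k : Fin 2 → ℝ → ℝ) : Fin 2 → ℝ → ℝ := fun j t =>
  p.κ₃ j * ∫ s in Ioo t T, h (s - t) * k j s

/-- Test functions: bounded measurable real functions of time. -/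
def IsTest {J : Type*} (k : J → ℝ → ℝ) : Prop :=
  ∀ j, Measurable (k j) ∧ ∃ C, ∀ t, |k j t| ≤ C

/-- Convergence of all the parameters of a family of circuits. -/
def CircuitTendsto (q : ℝ → Circuit) (p : Circuit) : Prop :=
  Tendsto (fun L => (q L).η) atTop (𝓝 p.η) ∧ Tendsto (fun L => (q L).ε) atTop (𝓝 p.ε) ∧
    Tendsto (fun L => (q L).ξ) atTop (𝓝 p.ξ) ∧ Tendsto (fun L => (q L).ψ) atTop (𝓝 p.ψ)

end Homodyne

end

/-! Coherent states turn the quantum statement into one about Poisson processes. The circuit acts on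
`n` photons as `S ⊗ ⋯ ⊗ S`, so a coherent vector of amplitude `U` leaves it with `n`-photon wave
functions proportional to `(SU)^{⊗n} / √n!`. The photon configurations are therefore Poisson with
intensity `|SU|²`, and a multiplicative functional `∏ c(x_l)` with `|c| = 1` has mean `exp(∫ c |SU|²
- ‖U‖²)` (`integral_photonLaw`). Unitarity of `S` replaces `‖U‖²` by `∫ |SU|²`; the exponent becomes
`∫ (c - 1) |SU|²`, and ports that collect no phase drop out (`integral_photonLaw_detPhase`). The
characteristic functionals of the counts, of `Z` and of `X / L` are all of this kind; for `X`,
exchanging the integrals first moves `h` onto the test function.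

For a local oscillator `L v`, the intensity is the sum of a term independent of `L`, an interference
term of order `L`, and `L² g₂ |v|²`, while the phases are `x / L` with convergent `x`. Against these
three terms `exp(i x / L) - 1` contributes asymptotically `0`, `i x` and `i L x - x² / 2`. The
detectors of a balanced pair carry opposite signs, so the divergent pieces combine into a multiple
of `Δ_{j2} L`, which the hypothesis keeps equal to `κ_{j3} G_{j2}`. In the interference term the
sign occurs twice, so the two contributions add up to `κ_{j3}`; the quadratic terms add up to
`κ_{j2}` (`tendsto_strong_oscillator`).

On the other side, `Φ^Z` is the expectation of a Weyl operator in a coherent state times explicit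
Gaussian factors. The cosine produced by `‖g‖²` is cancelled by the off-diagonal entries of `Ξ`, and
the remaining variances add up to `κ₂ / κ₃²` by `one_add_G₃_add` (`phiZ_eq`). The two sides thus
agree for fixed amplitudes. Averaging over the amplitudes is dominated convergence, since every
conditional characteristic functional has modulus at most `1`. -/

noncomputable section
namespace Homodyne

/-! ### Unitarity of the circuit, detector amplitudes, and the variance identity -/

namespace Circuit

variable (p : Circuit)

theorem tr_mul_self (j : Fin 4) : p.tr j * p.tr j = p.η j := by
  rw [tr, ← ofReal_mul, Real.mul_self_sqrt (p.η_pos j).le]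

theorem rf_mul_self (j : Fin 4) : p.rf j * p.rf j = -(1 - p.η j) := by
  have h : ((√(1 - p.η j) : ℝ) : ℂ) * (√(1 - p.η j) : ℝ) = 1 - p.η j := by
    rw [← ofReal_mul, Real.mul_self_sqrt (by linarith [p.η_lt_one j])]; push_cast; rfl
  rw [rf]
  linear_combination (-1 : ℂ) * h + ((√(1 - p.η j) : ℝ) : ℂ) * (√(1 - p.η j) : ℝ) * I_mul_I

theorem conj_tr (j : Fin 4) : conj (p.tr j) = p.tr j := conj_ofReal _

theorem conj_rf (j : Fin 4) : conj (p.rf j) = -p.rf j := by simp [rf]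

theorem conj_ph_mul (j : Fin 2) : conj (p.ph j) * p.ph j = 1 := by
  rw [ph, ← exp_conj, ← exp_add]; simp

theorem stageB_unitary : p.stageB.conjTranspose * p.stageB = 1 := by
  have h0 := p.tr_mul_self 0
  have h1 := p.rf_mul_self 0
  have h2 := p.tr_mul_self 1
  have h3 := p.rf_mul_self 1
  have h4 := p.conj_ph_mul 0
  have h5 := p.conj_ph_mul 1
  ext a b
  fin_cases a <;> fin_cases b <;>
    simp [stageB, Matrix.mul_apply, Fin.sum_univ_four, conj_tr, conj_rf]
  · linear_combination h0 - h1
  · ring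
  · ring
  · linear_combination h0 - h1
  · linear_combination h2 - h3 + p.tr 1 * p.tr 1 * h4 - p.rf 1 * p.rf 1 * h5
  · linear_combination p.tr 1 * p.rf 1 * (h4 - h5)
  · linear_combination p.tr 1 * p.rf 1 * (h5 - h4)
  · linear_combination h2 - h3 + p.tr 1 * p.tr 1 * h5 - p.rf 1 * p.rf 1 * h4

theorem stageC_unitary : p.stageC.conjTranspose * p.stageC = 1 := by
  have h0 := p.tr_mul_self 2
  have h1 := p.rf_mul_self 2
  have h2 := p.tr_mul_self 3
  have h3 := p.rf_mul_self 3
  ext a b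
  fin_cases a <;> fin_cases b <;>
    simp [stageC, Matrix.mul_apply, Fin.sum_univ_four, conj_tr, conj_rf]
  · linear_combination h0 - h1
  · ring
  · linear_combination h2 - h3
  · ring
  · ring
  · linear_combination h0 - h1
  · ring
  · linear_combination h2 - h3

theorem stageD_unitary : p.stageD.conjTranspose * p.stageD = 1 := by
  have h : ∀ j, ((√(p.ε j) : ℝ) : ℂ) * (√(p.ε j) : ℝ) = p.ε j := fun j => by
    rw [← ofReal_mul, Real.mul_self_sqrt (p.ε_pos j).le]
  have h' : ∀ j, ((√(1 - p.ε j) : ℝ) : ℂ) * (√(1 - p.ε j) : ℝ) = 1 - p.ε j := fun j => by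
    rw [← ofReal_mul, Real.mul_self_sqrt (by linarith [p.ε_le_one j])]; push_cast; rfl
  rw [stageD, Matrix.fromBlocks_conjTranspose, Matrix.fromBlocks_multiply,
    ← Matrix.fromBlocks_one]
  simp only [Matrix.diagonal_conjTranspose, Matrix.diagonal_mul_diagonal, Matrix.diagonal_add]
  congr 1
  · rw [← Matrix.diagonal_one]
    congr 1
    funext j
    simp only [Pi.star_apply, RCLike.star_def, map_mul, conj_I, conj_ofReal]
    linear_combination h j + h' j - ((√(1 - p.ε j) : ℝ) : ℂ) * (√(1 - p.ε j) : ℝ) * I_mul_I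
  · rw [← Matrix.diagonal_zero]
    congr 1
    funext j
    simp only [Pi.star_apply, RCLike.star_def, map_mul, conj_I, conj_ofReal]
    ring
  · rw [← Matrix.diagonal_zero]
    congr 1
    funext j
    simp only [Pi.star_apply, RCLike.star_def, map_mul, conj_I, conj_ofReal]
    ring
  · rw [← Matrix.diagonal_one]
    congr 1
    funext j
    simp only [Pi.star_apply, RCLike.star_def, map_mul, conj_I, conj_ofReal]
    linear_combination h j + h' j - ((√(1 - p.ε j) : ℝ) : ℂ) * (√(1 - p.ε j) : ℝ) * I_mul_I

/-- Unitarity is what conserves the photon number: it makes the normalization of the coherent state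
equal to the total output intensity. -/
theorem scattering_unitary : p.scattering.conjTranspose * p.scattering = 1 := by
  have h1 : (p.stageC * p.stageB).conjTranspose * (p.stageC * p.stageB) = 1 := by
    rw [Matrix.conjTranspose_mul, Matrix.mul_assoc, ← Matrix.mul_assoc _ p.stageC, stageC_unitary,
      Matrix.one_mul, stageB_unitary]
  have h2 : (Matrix.fromBlocks (p.stageC * p.stageB) 0 0 (1 : Matrix (Fin 4) (Fin 4) ℂ)).conjTranspose
      * Matrix.fromBlocks (p.stageC * p.stageB) 0 0 1 = 1 := by
    rw [Matrix.fromBlocks_conjTranspose, Matrix.fromBlocks_multiply, h1]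
    simp
  rw [scattering, Matrix.conjTranspose_reindex]
  simp only [Matrix.reindex_apply]
  rw [Matrix.submatrix_mul_equiv, Matrix.conjTranspose_mul, Matrix.mul_assoc,
    ← Matrix.mul_assoc _ p.stageD, stageD_unitary, Matrix.one_mul, h2, Matrix.submatrix_one_equiv]

/-- The scattering matrix preserves the Euclidean norm of the amplitudes. -/
theorem sum_norm_sq_scattering (a : Fin 8 → ℂ) :
    ∑ j, ‖∑ i, p.scattering j i * a i‖ ^ 2 = ∑ i, ‖a i‖ ^ 2 := by
  have h : ∀ b : Fin 8 → ℂ, ((∑ i, ‖b i‖ ^ 2 : ℝ) : ℂ) = star b ⬝ᵥ b := fun b => by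
    push_cast
    refine Finset.sum_congr rfl fun i _ => ?_
    rw [Pi.star_apply, RCLike.star_def, conj_mul']
  have h2 : ((∑ j, ‖∑ i, p.scattering j i * a i‖ ^ 2 : ℝ) : ℂ) = ((∑ i, ‖a i‖ ^ 2 : ℝ) : ℂ) := by
    rw [h a]
    refine (h (p.scattering.mulVec a)).trans ?_
    rw [Matrix.star_mulVec, Matrix.dotProduct_mulVec, Matrix.vecMul_vecMul, scattering_unitary,
      Matrix.vecMul_one]
  exact_mod_cast h2

/-- The last stage only attenuates the first four inputs; the other contribution to a detector comes
from the fields `A_{j+}`, which are in the vacuum. -/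
theorem scattering_castAdd (j i : Fin 4) :
    p.scattering (Fin.castAdd 4 j) (Fin.castAdd 4 i)
      = (√(p.ε j) : ℝ) * (p.stageC * p.stageB) j i := by
  have h (l : Fin 4) : finSumFinEquiv.symm (Fin.castAdd 4 l) = Sum.inl l :=
    finSumFinEquiv_symm_apply_castAdd l
  rw [scattering, stageD, Matrix.fromBlocks_multiply, Matrix.reindex_apply, Matrix.submatrix_apply,
    h, h]
  simp

/-- The intensity seen by the detector `j`, for amplitudes `a` of the signal and `b` of the local
oscillator. -/
theorem norm_sq_scattering (j : Fin 4) (a b : ℂ) :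
    ‖p.scattering (Fin.castAdd 4 j) 0 * a + p.scattering (Fin.castAdd 4 j) 2 * b‖ ^ 2 =
      ‖(√(p.g₁ j) : ℝ) * a + detSign j * I * p.ph (phaseIdx j) * (√(p.g₂ j) : ℝ) * b‖ ^ 2 := by
  have e0 := p.scattering_castAdd j 0
  have e2 := p.scattering_castAdd j 2
  have hη := fun j => (p.η_pos j).le
  have hη' : ∀ j, 0 ≤ 1 - p.η j := fun j => by linarith [p.η_lt_one j]
  change p.scattering (Fin.castAdd 4 j) 0 = _ at e0
  change p.scattering (Fin.castAdd 4 j) 2 = _ at e2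
  rw [e0, e2]
  -- The circuit amplitude agrees with the displayed one up to a constant phase `c`, equal to `1, i,
  -- i, -1` for the four detectors, which the modulus does not see.
  have key : ∀ (c x y : ℂ), ‖c‖ = 1 → x = c * y → ‖x‖ ^ 2 = ‖y‖ ^ 2 := fun c x y hc h => by
    rw [h, norm_mul, hc, one_mul]
  fin_cases j
  · refine key 1 _ _ (by simp) ?_
    simp [Matrix.mul_apply, Fin.sum_univ_four, stageC, stageB, g₁, g₂, detSign, phaseIdx, tr, rf,
      Real.sqrt_mul, hη, hη', mul_nonneg]
    ring
  · refine key I _ _ (by simp) ?_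
    simp [Matrix.mul_apply, Fin.sum_univ_four, stageC, stageB, g₁, g₂, detSign, phaseIdx, tr, rf,
      Real.sqrt_mul, hη, hη', mul_nonneg]
    ring
  · refine key I _ _ (by simp) ?_
    simp [Matrix.mul_apply, Fin.sum_univ_four, stageC, stageB, g₁, g₂, detSign, phaseIdx, tr, rf,
      Real.sqrt_mul, hη, hη', mul_nonneg]
    ring_nf
    simp
  · refine key (-1) _ _ (by simp) ?_
    simp [Matrix.mul_apply, Fin.sum_univ_four, stageC, stageB, g₁, g₂, detSign, phaseIdx, tr, rf,
      Real.sqrt_mul, hη, hη', mul_nonneg]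
    ring_nf
    simp
    ring

theorem κ₃_pos (j : Fin 2) : 0 < p.κ₃ j := by
  have hη := p.η_pos
  have hη' : ∀ j, 0 < 1 - p.η j := fun j => by linarith [p.η_lt_one j]
  have hε := p.ε_pos
  have hξ := p.ξ_pos
  fin_cases j
  · have := hη 0; have := hη 1; have := hη 2; have := hη' 2; have := hε 0; have := hε 2
    have := hξ 0; have := hξ 2
    simp only [κ₃, Fin.zero_eta, Matrix.cons_val_zero]
    positivity
  · have := hη' 0; have := hη' 1; have := hη 3; have := hη' 3; have := hε 1; have := hε 3
    have := hξ 1; have := hξ 3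
    simp only [κ₃, Fin.mk_one, Matrix.cons_val_one, Matrix.cons_val_zero]
    positivity

/-- The left side is the sum of vacuum noise (`1 + G₃`, equal to `1/η₁` or `1/(1-η₁)`), loss noise
and imbalance. With `a`, `b` the two values of `ε ξ` in a pair and `η` the transmissivity of its
beam splitter, all reduces to `(1-η)a² + ηb² = ((1-η)a - ηb)² + η(1-η)(a+b)²`. -/
theorem one_add_G₃_add (j : Fin 2) :
    1 + p.G₃ j + p.σsq j + p.Vsq j = p.κ₂ j / p.κ₃ j ^ 2 := by
  have hη := p.η_pos
  have hη' : ∀ j, 0 < 1 - p.η j := fun j => by linarith [p.η_lt_one j]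
  have hε := p.ε_pos
  have hξ := p.ξ_pos
  fin_cases j
  · have h1 := hη 0; have h2 := hη 1; have h3 := hη 2; have h4 := hη' 2
    have h5 : 0 < p.ε 0 * p.ξ 0 + p.ε 2 * p.ξ 2 :=
      add_pos (mul_pos (hε 0) (hξ 0)) (mul_pos (hε 2) (hξ 2))
    simp only [G₃, σsq, Vsq, κ₂, κ₃, Δ₂, Fin.zero_eta, Matrix.cons_val_zero]
    rw [mul_pow (√_), Real.sq_sqrt (by positivity)]
    have h1 := h1.ne'; have h2 := h2.ne'; have h3 := h3.ne'; have h4 := h4.ne'; have h5 := h5.ne'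
    field_simp
    ring
  · have h1 := hη' 0; have h2 := hη' 1; have h3 := hη 3; have h4 := hη' 3
    have h5 : 0 < p.ε 1 * p.ξ 1 + p.ε 3 * p.ξ 3 :=
      add_pos (mul_pos (hε 1) (hξ 1)) (mul_pos (hε 3) (hξ 3))
    simp only [G₃, σsq, Vsq, κ₂, κ₃, Δ₂, Fin.mk_one, Matrix.cons_val_one, Matrix.cons_val_zero]
    rw [mul_pow (√_), Real.sq_sqrt (by positivity)]
    have h1 := h1.ne'; have h2 := h2.ne'; have h3 := h3.ne'; have h4 := h4.ne'; have h5 := h5.ne'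
    field_simp
    ring

end Circuit

/-! ### The measure on (port, time), as eight copies of Lebesgue measure -/

theorem portMeasure_eq :
    portMeasure = Measure.sum fun i : Fin 8 => (volume : Measure ℝ).map (Prod.mk i) := by
  rw [portMeasure, Measure.count, Measure.prod_sum_left]
  simp only [Measure.dirac_prod]

theorem measurableEmbedding_prodMk (i : Fin 8) :
    MeasurableEmbedding (Prod.mk i : ℝ → Fin 8 × ℝ) := MeasurableEmbedding.id.prodMk_left i

theorem aestronglyMeasurable_portMeasure {f : Fin 8 × ℝ → ℂ}
    (h : ∀ i, AEStronglyMeasurable (fun t => f (i, t)) volume) :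
    AEStronglyMeasurable f portMeasure := by
  rw [portMeasure_eq, aestronglyMeasurable_sum_measure_iff]
  exact fun i => (measurableEmbedding_prodMk i).aestronglyMeasurable_map_iff.2 (h i)

theorem integrable_portMeasure_iff {E : Type*} [NormedAddCommGroup E] {f : Fin 8 × ℝ → E} :
    Integrable f portMeasure ↔ ∀ i, Integrable (fun t => f (i, t)) volume := by
  rw [portMeasure_eq]
  refine ⟨fun h i => ?_, fun h => integrable_sum_measure (fun i => ?_) Summable.of_finite⟩
  · exact (measurableEmbedding_prodMk i).integrable_map_iff.1 (h.mono_measure (Measure.le_sum _ i))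
  · exact (measurableEmbedding_prodMk i).integrable_map_iff.2 (h i)

theorem integral_portMeasure {f : Fin 8 × ℝ → ℂ} (hf : Integrable f portMeasure) :
    ∫ y, f y ∂portMeasure = ∑ i, ∫ t, f (i, t) := by
  rw [portMeasure_eq] at hf ⊢
  rw [integral_sum_measure hf, tsum_fintype]
  exact Finset.sum_congr rfl fun i _ => (measurableEmbedding_prodMk i).integral_map _

theorem memLp_portMeasure {f : Fin 8 × ℝ → ℂ} (h : ∀ i, MemLp (fun t => f (i, t)) 2 volume) :
    MemLp f 2 portMeasure := by
  rw [memLp_two_iff_integrable_sq_norm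
    (aestronglyMeasurable_portMeasure fun i => (h i).aestronglyMeasurable),
    integrable_portMeasure_iff]
  exact fun i => (memLp_two_iff_integrable_sq_norm (h i).aestronglyMeasurable).1 (h i)

theorem ae_portMeasure_iff {P : Fin 8 × ℝ → Prop} :
    (∀ᵐ y ∂portMeasure, P y) ↔ ∀ i, ∀ᵐ t ∂(volume : Measure ℝ), P (i, t) := by
  rw [portMeasure_eq, Measure.ae_sum_iff]
  exact forall_congr' fun i => (measurableEmbedding_prodMk i).ae_map_iff

/-- Permuting the ports preserves the measure on (port, time). -/
theorem measurePreserving_port (σ : Equiv.Perm (Fin 8)) :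
    MeasurePreserving (fun y : Fin 8 × ℝ => (σ y.1, y.2)) portMeasure portMeasure := by
  have hm : Measurable fun y : Fin 8 × ℝ => (σ y.1, y.2) :=
    ((measurable_of_finite σ).comp measurable_fst).prodMk measurable_snd
  refine ⟨hm, ?_⟩
  refine Measure.ext fun s hs => ?_
  have key (s) (hs : MeasurableSet s) :
      portMeasure s = ∑ i, (volume : Measure ℝ) (Prod.mk i ⁻¹' s) := by
    rw [portMeasure_eq, Measure.sum_apply _ hs, tsum_fintype]
    exact Finset.sum_congr rfl fun i _ => Measure.map_apply measurable_prodMk_left hs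
  rw [Measure.map_apply hm hs, key _ (hm hs), key _ hs]
  exact Equiv.sum_comp σ fun i => (volume : Measure ℝ) (Prod.mk i ⁻¹' s)

/-- A property that holds for almost all arguments holds for almost all arguments also after
replacing their ports. -/
theorem ae_pi_replace_port {n : ℕ} {P : (Fin n → Fin 8 × ℝ) → Prop}
    (h : ∀ᵐ x ∂Measure.pi fun _ : Fin n => portMeasure, P x) :
    ∀ᵐ x ∂Measure.pi fun _ : Fin n => portMeasure,
      ∀ i : Fin n → Fin 8, P fun l => (i l, (x l).2) := by
  -- Overwriting a port does not preserve the measure, but a transposition does. For each of the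
  -- finitely many `m` the transpositions form a fixed measure-preserving map; choosing `m`
  -- afterwards as the actual ports of `x` turns it into the replacement by `i`.
  have key : ∀ᵐ x ∂Measure.pi fun _ : Fin n => portMeasure, ∀ i m : Fin n → Fin 8,
      P fun l => (Equiv.swap (m l) (i l) (x l).1, (x l).2) := by
    refine ae_all_iff.2 fun i => ae_all_iff.2 fun m => ?_
    exact (measurePreserving_pi (fun _ : Fin n => portMeasure) (fun _ : Fin n => portMeasure)
      fun l => measurePreserving_port (Equiv.swap (m l) (i l))).quasiMeasurePreserving.ae h
  filter_upwards [key] with x hx i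
  simpa using hx i fun l => (x l).1

/-! ### The photon law of a coherent state -/

theorem wave_cohVec (U : Lp ℂ 2 portMeasure) (n : ℕ) :
    wave (cohVec U) n =ᵐ[Measure.pi fun _ : Fin n => portMeasure] fun x =>
      (Real.exp (-(‖U‖ ^ 2) / 2) : ℂ) * (((√(n.factorial : ℝ) : ℝ) : ℂ)⁻¹ * ∏ l, U (x l)) := by
  change ⇑((Real.exp (-(‖U‖ ^ 2) / 2) : ℂ) • (((√(n.factorial : ℝ) : ℝ) : ℂ)⁻¹ • tpow n U)) =ᵐ[_] _
  filter_upwards [Lp.coeFn_smul (Real.exp (-(‖U‖ ^ 2) / 2) : ℂ)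
    (((√(n.factorial : ℝ) : ℝ) : ℂ)⁻¹ • tpow n U), Lp.coeFn_smul (((√(n.factorial : ℝ) : ℝ) : ℂ)⁻¹)
      (tpow n U), (memLp_prod n U).coeFn_toLp] with x h1 h2 h3
  rw [h1, Pi.smul_apply, h2, Pi.smul_apply, tpow, h3]
  rfl

/-- The one-photon amplitude at the output. -/
def outputAmp (S : Matrix (Fin 8) (Fin 8) ℂ) (u : Fin 8 × ℝ → ℂ) (y : Fin 8 × ℝ) : ℂ :=
  ∑ i, S y.1 i * u (i, y.2)

/-- The sum over all port assignments factorizes photon by photon, so tensor powers go to tensor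
powers. The formula for `wave` holds only almost everywhere and is used at arguments with replaced
ports, hence `ae_pi_replace_port`. -/
theorem outputWave_cohVec (S : Matrix (Fin 8) (Fin 8) ℂ) (U : Lp ℂ 2 portMeasure) (n : ℕ) :
    outputWave S (cohVec U) n =ᵐ[Measure.pi fun _ : Fin n => portMeasure] fun x =>
      (Real.exp (-(‖U‖ ^ 2) / 2) : ℂ) *
        (((√(n.factorial : ℝ) : ℝ) : ℂ)⁻¹ * ∏ l, outputAmp S U (x l)) := by
  filter_upwards [ae_pi_replace_port (wave_cohVec U n)] with x hx
  simp only [outputWave, hx, outputAmp]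
  rw [Finset.prod_univ_sum, Fintype.piFinset_univ, Finset.mul_sum, Finset.mul_sum]
  refine Finset.sum_congr rfl fun i _ => ?_
  rw [Finset.prod_mul_distrib]
  ring

theorem outputAmp_congr {S : Matrix (Fin 8) (Fin 8) ℂ} {u v : Fin 8 × ℝ → ℂ}
    (h : u =ᵐ[portMeasure] v) : outputAmp S u =ᵐ[portMeasure] outputAmp S v := by
  have h' := ae_all_iff.2 (ae_portMeasure_iff.1 h)
  refine ae_portMeasure_iff.2 fun j => ?_
  filter_upwards [h'] with t ht
  simp only [outputAmp, ht]

theorem measurable_outputAmp (S : Matrix (Fin 8) (Fin 8) ℂ) {u : Fin 8 × ℝ → ℂ}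
    (hu : Measurable u) : Measurable (outputAmp S u) := by
  unfold outputAmp
  refine Finset.measurable_fun_sum _ fun i _ => Measurable.mul ?_ ?_
  · exact (measurable_of_finite fun j => S j i).comp measurable_fst
  · exact hu.comp (measurable_const.prodMk measurable_snd)

theorem integrable_norm_sq_outputAmp (S : Matrix (Fin 8) (Fin 8) ℂ) (U : Lp ℂ 2 portMeasure) :
    Integrable (fun y => ‖outputAmp S U y‖ ^ 2) portMeasure := by
  have hU := (Lp.stronglyMeasurable U).measurable
  have h := integrable_portMeasure_iff.1
    ((memLp_two_iff_integrable_sq_norm hU.aestronglyMeasurable).1 (Lp.memLp U))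
  refine integrable_portMeasure_iff.2 fun j => ?_
  have hm : Measurable fun t : ℝ => outputAmp S U (j, t) :=
    (measurable_outputAmp S hU).comp measurable_prodMk_left
  refine (memLp_two_iff_integrable_sq_norm hm.aestronglyMeasurable).1 ?_
  simp only [outputAmp]
  refine memLp_finsetSum _ fun i _ => MemLp.const_mul ?_ _
  have hm' : Measurable fun t : ℝ => U (i, t) := hU.comp measurable_prodMk_left
  exact (memLp_two_iff_integrable_sq_norm hm'.aestronglyMeasurable).2 (h i)

theorem measurable_sigmaMk (n : ℕ) :
    Measurable fun x : Fin n → Fin 8 × ℝ => (⟨n, x⟩ : Config) := by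
  intro s hs
  exact (MeasurableSpace.measurableSet_iInf.1 hs) n

theorem measurable_config {E : Type*} [MeasurableSpace E] {F : Config → E}
    (h : ∀ n, Measurable fun x : Fin n → Fin 8 × ℝ => F ⟨n, x⟩) : Measurable F := by
  intro s hs
  exact MeasurableSpace.measurableSet_iInf.2 fun n => h n hs

/-- The generating functional of the photon law of a coherent state. -/
theorem integral_photonLaw (S : Matrix (Fin 8) (Fin 8) ℂ) (U : Lp ℂ 2 portMeasure)
    {c : Fin 8 × ℝ → ℂ} (hc : Measurable c) (hc1 : ∀ y, ‖c y‖ = 1) :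
    ∫ x, ∏ l, c (x.2 l) ∂photonLaw S (cohVec U) =
      Complex.exp ((∫ y, c y * (‖outputAmp S U y‖ ^ 2 : ℝ) ∂portMeasure) - (‖U‖ ^ 2 : ℝ)) := by
  set V := outputAmp S U with hV
  have hVm : Measurable V := measurable_outputAmp S (Lp.stronglyMeasurable U).measurable
  have hVi : Integrable (fun y => ‖V y‖ ^ 2) portMeasure := integrable_norm_sq_outputAmp S U
  set F : Config → ℂ := fun x => ∏ l, c (x.2 l) with hF
  have hFm : Measurable F := measurable_config fun n => by
    refine Finset.measurable_fun_prod Finset.univ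
      (f := fun (l : Fin n) (x : Fin n → Fin 8 × ℝ) => c (x l)) fun l _ => ?_
    exact hc.comp (measurable_pi_apply l)
  set A : ℝ := Real.exp (-(‖U‖ ^ 2)) with hA
  -- The Poisson density: `exp(-‖U‖²) / n!` times a product of one-photon intensities.
  have hnorm (n : ℕ) : (fun x => ‖outputWave S (cohVec U) n x‖ ^ 2)
      =ᵐ[Measure.pi fun _ : Fin n => portMeasure] fun x =>
        A * ((n.factorial : ℝ)⁻¹ * ∏ l, ‖V (x l)‖ ^ 2) := by
    filter_upwards [outputWave_cohVec S U n] with x hx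
    rw [hx, norm_mul, norm_mul, norm_inv, Complex.norm_real, Complex.norm_real, norm_prod,
      Real.norm_of_nonneg (Real.exp_pos _).le, Real.norm_of_nonneg (Real.sqrt_nonneg _), mul_pow,
      mul_pow, inv_pow, Real.sq_sqrt (by positivity), ← Finset.prod_pow, hA, ← Real.exp_nat_mul]
    congr 2
    push_cast
    ring
  let ν (n : ℕ) : Measure (Fin n → Fin 8 × ℝ) :=
    (Measure.pi fun _ : Fin n => portMeasure).withDensity fun x =>
      ENNReal.ofReal (‖outputWave S (cohVec U) n x‖ ^ 2)
  have hν (n : ℕ) : ν n = (Measure.pi fun _ : Fin n => portMeasure).withDensity fun x =>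
      ENNReal.ofReal (A * ((n.factorial : ℝ)⁻¹ * ∏ l, ‖V (x l)‖ ^ 2)) := by
    refine withDensity_congr_ae ?_
    filter_upwards [hnorm n] with x hx
    rw [hx]
  have hdm (n : ℕ) : Measurable fun x : Fin n → Fin 8 × ℝ =>
      ENNReal.ofReal (A * ((n.factorial : ℝ)⁻¹ * ∏ l, ‖V (x l)‖ ^ 2)) :=
    ((Finset.measurable_fun_prod _ fun l _ =>
      ((hVm.comp (measurable_pi_apply l)).norm.pow_const 2)).const_mul _).const_mul _
      |>.ennreal_ofReal
  have hdn (n : ℕ) (x : Fin n → Fin 8 × ℝ) :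
      0 ≤ A * ((n.factorial : ℝ)⁻¹ * ∏ l, ‖V (x l)‖ ^ 2) := by
    have : 0 < A := Real.exp_pos _
    have : 0 ≤ ∏ l, ‖V (x l)‖ ^ 2 := Finset.prod_nonneg fun l _ => by positivity
    positivity
  have hint {E : Type} [NormedAddCommGroup E] [NormedSpace ℝ E] (n : ℕ)
      (f : (Fin n → Fin 8 × ℝ) → E) : ∫ x, f x ∂ν n =
        ∫ x, (A * ((n.factorial : ℝ)⁻¹ * ∏ l, ‖V (x l)‖ ^ 2)) • f x
          ∂Measure.pi fun _ : Fin n => portMeasure := by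
    rw [hν, integral_withDensity_eq_integral_toReal_smul (hdm n) (by simp)]
    simp only [ENNReal.toReal_ofReal (hdn n _)]
  have hFn (x : Config) : ‖F x‖ = 1 := by
    simp only [hF, norm_prod, hc1, Finset.prod_const_one]
  have hFi (n : ℕ) : Integrable (fun x : Fin n → Fin 8 × ℝ => F ⟨n, x⟩) (ν n) := by
    rw [hν, integrable_withDensity_iff_integrable_smul' (hdm n) (by simp)]
    simp only [ENNReal.toReal_ofReal (hdn n _)]
    have h1 : Integrable (fun x : Fin n → Fin 8 × ℝ => ∏ l, ‖V (x l)‖ ^ 2)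
        (Measure.pi fun _ => portMeasure) :=
      Integrable.fintype_prod (ι := Fin n) (f := fun _ y => ‖V y‖ ^ 2) fun _ => hVi
    have h2 := (h1.const_mul (n.factorial : ℝ)⁻¹).const_mul A
    refine h2.mono (h2.aestronglyMeasurable.smul
        (hFm.comp (measurable_sigmaMk n)).aestronglyMeasurable) (Eventually.of_forall fun x => ?_)
    rw [norm_smul, hFn, mul_one]
  have hcalc (n : ℕ) : ∫ x, F ⟨n, x⟩ ∂ν n =
      A * ((∫ y, c y * (‖V y‖ ^ 2 : ℝ) ∂portMeasure) ^ n / n.factorial) := by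
    rw [hint]
    have h1 (x : Fin n → Fin 8 × ℝ) : (A * ((n.factorial : ℝ)⁻¹ * ∏ l, ‖V (x l)‖ ^ 2)) • F ⟨n, x⟩ =
        (A * (n.factorial : ℂ)⁻¹) * ∏ l, (c (x l) * (‖V (x l)‖ ^ 2 : ℝ)) := by
      simp only [hF, Finset.prod_mul_distrib, real_smul]
      push_cast
      ring
    simp only [h1]
    rw [integral_const_mul, integral_fintype_prod_eq_pow (fun y => c y * (‖V y‖ ^ 2 : ℝ)),
      Fintype.card_fin]
    ring
  have hcalc' (n : ℕ) : ∫ x, ‖F ⟨n, x⟩‖ ∂ν n =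
      A * ((∫ y, ‖V y‖ ^ 2 ∂portMeasure) ^ n / n.factorial) := by
    rw [hint]
    simp only [hFn, smul_eq_mul, mul_one]
    rw [integral_const_mul, integral_const_mul, integral_fintype_prod_eq_pow (fun y => ‖V y‖ ^ 2),
      Fintype.card_fin]
    ring
  -- Because `|F| = 1`, the sum of the integrals of the norms over `n` is an exponential series.
  have hsum : Integrable F (Measure.sum fun n => (ν n).map (Sigma.mk n)) := by
    refine integrable_sum_measure (fun n => ?_) ?_
    · rw [integrable_map_measure hFm.aestronglyMeasurable (measurable_sigmaMk n).aemeasurable]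
      exact hFi n
    · refine ((Real.summable_pow_div_factorial
        (∫ y, ‖V y‖ ^ 2 ∂portMeasure)).mul_left A).congr fun n => ?_
      rw [integral_map (measurable_sigmaMk n).aemeasurable hFm.norm.aestronglyMeasurable, hcalc']
  change ∫ x, F x ∂(Measure.sum fun n => (ν n).map (Sigma.mk n)) = _
  have hexp (z : ℂ) : Complex.exp z = ∑' n : ℕ, z ^ n / n.factorial := by
    rw [Complex.exp_eq_exp_ℂ, NormedSpace.exp_eq_tsum_div]
  rw [integral_sum_measure hsum, sub_eq_neg_add, Complex.exp_add, hexp (∫ y, _ ∂portMeasure),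
    ← tsum_mul_left]
  refine tsum_congr fun n => ?_
  rw [integral_map (measurable_sigmaMk n).aemeasurable hFm.aestronglyMeasurable, hcalc, hA]
  push_cast
  rfl

/-! ### The explicit Gaussian form of `Φ^Z` -/

section Fock

variable {X : Type*} [MeasurableSpace X] {μ : Measure X} [SigmaFinite μ]

/-- Parseval's identity, valid for whichever Hilbert basis the definition of the trace has chosen.
-/
theorem fockTrace_comp_pureState (B : Fock μ →L[ℂ] Fock μ) (ψ : Fock μ) :
    fockTrace (B ∘L pureState ψ) = inner ℂ ψ (B ψ) := by
  have key (b : HilbertBasis (exists_hilbertBasis ℂ (Fock μ)).choose ℂ (Fock μ)) :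
      ∑' i, inner ℂ (b i) ((B ∘L pureState ψ) (b i)) = inner ℂ ψ (B ψ) := by
    rw [← (b.hasSum_inner_mul_inner ψ (B ψ)).tsum_eq]
    refine tsum_congr fun i => ?_
    rw [ContinuousLinearMap.comp_apply, pureState, InnerProductSpace.rankOne_apply, map_smul,
      inner_smul_right]
  exact key _

/-- The two normalization factors of the coherent vector cancel `⟪w, w⟫`; the displacement leaves
the vacuum factor `-‖g‖²/2` and a purely imaginary exponent. -/
theorem inner_cohVec_weyl (w g : Lp ℂ 2 μ) :
    inner ℂ (cohVec w) (weyl g (cohVec w)) =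
      Complex.exp (-((‖g‖ ^ 2 : ℝ) : ℂ) / 2 + inner ℂ w g - inner ℂ g w) := by
  have hn : inner ℂ w w = (‖w‖ : ℂ) ^ 2 := inner_self_eq_norm_sq_to_K w
  rw [cohVec, map_smul, weyl_expVec, inner_smul_left, inner_smul_right, inner_smul_right,
    inner_expVec, conj_ofReal, ofReal_exp, ← Complex.exp_add, ← Complex.exp_add, ← Complex.exp_add]
  congr 1
  rw [inner_add_right, hn]
  push_cast
  ring

end Fock

section ToL2

variable {X : Type*} [MeasurableSpace X] {μ : Measure X}

theorem toL2_eq {u : X → ℂ} (hu : MemLp u 2 μ) : toL2 μ u = hu.toLp u := by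
  rw [toL2, dif_pos hu]

theorem inner_toL2 {u v : X → ℂ} (hu : MemLp u 2 μ) (hv : MemLp v 2 μ) :
    inner ℂ (toL2 μ u) (toL2 μ v) = ∫ x, v x * conj (u x) ∂μ := by
  rw [toL2_eq hu, toL2_eq hv, L2.inner_def]
  refine integral_congr_ae ?_
  filter_upwards [hu.coeFn_toLp, hv.coeFn_toLp] with x h1 h2
  rw [h1, h2, RCLike.inner_apply]

theorem norm_sq_toL2 {u : X → ℂ} (hu : MemLp u 2 μ) :
    ‖toL2 μ u‖ ^ 2 = ∫ x, ‖u x‖ ^ 2 ∂μ := by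
  have h := inner_toL2 hu hu
  have hn : inner ℂ (toL2 μ u) (toL2 μ u) = (‖toL2 μ u‖ : ℂ) ^ 2 := inner_self_eq_norm_sq_to_K _
  rw [hn] at h
  have h2 : (fun x => u x * conj (u x)) = fun x => ((‖u x‖ ^ 2 : ℝ) : ℂ) := by
    funext x
    rw [mul_conj']
    push_cast
    rfl
  rw [h2, integral_complex_ofReal] at h
  exact_mod_cast h

end ToL2

theorem memLp_window {T : ℝ} {u : ℝ → ℂ} (hu : MemLp u 2 (volume.restrict (Ioo 0 T))) :
    MemLp (window T u) 2 volume := (memLp_indicator_iff_restrict measurableSet_Ioo).2 hu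

section PhiZ

variable {T : ℝ} {u v : ℝ → ℂ}

theorem integrable_norm_sq (hv : MemLp v 2 (volume.restrict (Ioo 0 T))) :
    Integrable (fun t => ‖v t‖ ^ 2) (volume.restrict (Ioo 0 T)) :=
  (memLp_two_iff_integrable_sq_norm hv.aestronglyMeasurable).1 hv

theorem integrable_ofReal_norm_sq (hv : MemLp v 2 (volume.restrict (Ioo 0 T))) :
    Integrable (fun t => (‖v t‖ : ℂ) ^ 2) (volume.restrict (Ioo 0 T)) := by
  simpa using (integrable_norm_sq hv).ofReal (𝕜 := ℂ)

theorem integrable_mul_conj (hu : MemLp u 2 (volume.restrict (Ioo 0 T)))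
    (hv : MemLp v 2 (volume.restrict (Ioo 0 T))) :
    Integrable (fun t => conj (u t) * v t) (volume.restrict (Ioo 0 T)) := by
  have := L2.integrable_inner (𝕜 := ℂ) (hu.toLp u) (hv.toLp v)
  refine this.congr ?_
  filter_upwards [hu.coeFn_toLp, hv.coeFn_toLp] with x h1 h2
  rw [h1, h2, RCLike.inner_apply, mul_comm]

theorem IsTest.integrable_mul {J : Type*} {k : J → ℝ → ℝ} (hk : IsTest k) (j : J) {f : ℝ → ℂ}
    {ν : Measure ℝ} (hf : Integrable f ν) : Integrable (fun t => (k j t : ℂ) * f t) ν := by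
  obtain ⟨hm, C, hC⟩ := hk j
  refine hf.bdd_mul (c := C) (measurable_ofReal.comp hm).aestronglyMeasurable
    (Eventually.of_forall fun t => ?_)
  rw [norm_real]
  exact hC t

theorem IsTest.memLp_mul {J : Type*} {k : J → ℝ → ℝ} (hk : IsTest k) (j : J) {f : ℝ → ℂ}
    {ν : Measure ℝ} (hf : MemLp f 2 ν) : MemLp (fun t => (k j t : ℂ) * f t) 2 ν := by
  obtain ⟨hm, C, hC⟩ := hk j
  refine (hf.const_mul (C : ℂ)).mono
    ((measurable_ofReal.comp hm).aestronglyMeasurable.mul hf.aestronglyMeasurable)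
    (Eventually.of_forall fun t => ?_)
  rw [norm_mul, norm_mul, norm_real, norm_real]
  exact mul_le_mul_of_nonneg_right ((hC t).trans (le_abs_self C)) (norm_nonneg _)

/-- The cross term is the noncommutativity-free overlap of the two quadratures in the vacuum; it is
what the off-diagonal part of `Ξ` compensates. -/
theorem norm_sq_phase_sum (p : Circuit) (a b : ℝ) :
    ‖a * p.ph 0 + b * p.ph 1‖ ^ 2 = a ^ 2 + b ^ 2 + 2 * a * b * Real.cos (p.ψ 1 - p.ψ 0) := by
  have h (j : Fin 2) : p.ph j = (Real.cos (p.ψ j) : ℝ) + (Real.sin (p.ψ j) : ℝ) * I := by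
    rw [Circuit.ph, mul_comm, exp_mul_I, ofReal_cos, ofReal_sin]
  rw [Complex.sq_norm, normSq_apply, h, h, Real.cos_sub]
  simp only [add_re, mul_re, ofReal_re, I_re, ofReal_im, I_im, add_im, mul_im]
  linear_combination a ^ 2 * Real.cos_sq_add_sin_sq (p.ψ 0) + b ^ 2 * Real.cos_sq_add_sin_sq (p.ψ 1)

/-- The factor `-½‖g‖²` adds to `-½ k·Ξk |v|²` so that the cosines cancel and `1 + G₃` remains on
the diagonal; `Γ` contributes `σ² + V²`, and `one_add_G₃_add` collects the sum. The linear term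
comes from `⟪w, g⟫ - ⟪g, w⟫`. -/
theorem phiZ_eq (p : Circuit) (G : Fin 2 → ℝ) (hu : MemLp u 2 (volume.restrict (Ioo 0 T)))
    (hv : MemLp v 2 (volume.restrict (Ioo 0 T))) {k : Fin 2 → ℝ → ℝ} (hk : IsTest k) :
    phiZ p G T k u v = Complex.exp (∑ j, ∫ t in Ioo 0 T,
      (I * k j t * (G j * ‖v t‖ ^ 2
          + (I * Complex.exp (I * p.ψ j) * conj (u t) * v t
            + conj (I * Complex.exp (I * p.ψ j) * conj (u t) * v t)))
        - p.κ₂ j / (2 * p.κ₃ j ^ 2) * (k j t) ^ 2 * ‖v t‖ ^ 2)) := by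
  set ν := (volume : Measure ℝ).restrict (Ioo 0 T) with hν
  set g : ℝ → ℂ := fun t => ∑ j, I * k j t * (I * p.ph j * v t) with hg
  have hvv := integrable_ofReal_norm_sq hv
  have huv := integrable_mul_conj hu hv
  have hkk (i j : Fin 2) : Integrable (fun t => (k i t : ℂ) * ((k j t : ℂ) * (‖v t‖ : ℂ) ^ 2)) ν :=
    hk.integrable_mul i (hk.integrable_mul j hvv)
  have hgL : MemLp g 2 ν := by
    refine memLp_finsetSum _ fun j _ => ?_
    have e : (fun t => I * k j t * (I * p.ph j * v t)) =
        fun t => I * I * p.ph j * (k j t * v t) := by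
      funext t
      ring
    rw [e]
    exact (hk.memLp_mul j hv).const_mul _
  have hnorm : ∀ t, (‖g t‖ : ℂ) ^ 2 = ((k 0 t : ℂ) ^ 2 + (k 1 t : ℂ) ^ 2
      + 2 * k 0 t * k 1 t * (Real.cos (p.ψ 1 - p.ψ 0) : ℝ)) * (‖v t‖ : ℂ) ^ 2 := by
    intro t
    have h1 : g t = -(k 0 t * p.ph 0 + k 1 t * p.ph 1) * v t := by
      simp only [hg, Fin.sum_univ_two]
      linear_combination (k 0 t * p.ph 0 * v t + k 1 t * p.ph 1 * v t) * I_mul_I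
    have h2 : ‖g t‖ ^ 2 = (k 0 t ^ 2 + k 1 t ^ 2
        + 2 * k 0 t * k 1 t * Real.cos (p.ψ 1 - p.ψ 0)) * ‖v t‖ ^ 2 := by
      rw [h1, norm_mul, norm_neg, mul_pow, norm_sq_phase_sum]
    exact_mod_cast h2
  have hwg := inner_toL2 (memLp_window hu) (memLp_window hgL)
  have hgw := inner_toL2 (memLp_window hgL) (memLp_window hu)
  have hgg := norm_sq_toL2 (memLp_window hgL)
  have hwin (f f' : ℝ → ℂ) : ∫ t, window T f t * conj (window T f' t) = ∫ t, f t * conj (f' t) ∂ν := by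
    rw [hν, ← integral_indicator measurableSet_Ioo]
    refine integral_congr_ae (Eventually.of_forall fun t => ?_)
    by_cases ht : t ∈ Ioo 0 T <;> simp [window, ht]
  have hwin' : ∫ t, ‖window T g t‖ ^ 2 = ∫ t, ‖g t‖ ^ 2 ∂ν := by
    rw [hν, ← integral_indicator measurableSet_Ioo]
    refine integral_congr_ae (Eventually.of_forall fun t => ?_)
    by_cases ht : t ∈ Ioo 0 T <;> simp [window, ht]
  rw [hwin] at hwg hgw
  rw [hwin'] at hgg
  rw [phiZ, phiQ, fockTrace_comp_pureState, psiQ, smul_apply, inner_smul_right,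
    inner_cohVec_weyl, hwg, hgw, hgg, gammaT, ofReal_exp, ← Complex.exp_add, ← Complex.exp_add,
    ← integral_complex_ofReal, ← integral_complex_ofReal]
  congr 1
  have i1 : Integrable (fun t => ((-(1 / 2) * (∑ j, ∑ i, k j t * p.Ξ j i * k i t) * ‖v t‖ ^ 2 : ℝ)
      : ℂ)) ν := by
    have := (((hkk 0 0).const_mul (p.Ξ 0 0 : ℂ)).add ((hkk 0 1).const_mul (p.Ξ 0 1 : ℂ))).add
      (((hkk 1 0).const_mul (p.Ξ 1 0 : ℂ)).add ((hkk 1 1).const_mul (p.Ξ 1 1 : ℂ)))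
    refine (this.const_mul (-(1 / 2))).congr (Eventually.of_forall fun t => ?_)
    simp only [Fin.sum_univ_two, Pi.add_apply]
    push_cast
    ring
  have i2 : Integrable (fun t => ((‖g t‖ ^ 2 : ℝ) : ℂ)) ν := by
    simpa using integrable_ofReal_norm_sq hgL
  have i3 : Integrable (fun t => g t * conj (u t)) ν := by
    simpa [mul_comm] using integrable_mul_conj hu hgL
  have i4 : Integrable (fun t => u t * conj (g t)) ν := by
    simpa [mul_comm] using integrable_mul_conj hgL hu
  have i5 : Integrable (fun t => ((‖v t‖ ^ 2 : ℝ) : ℂ) *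
      ∑ j, (I * k j t * G j - ((p.σsq j + p.Vsq j) / 2 * k j t ^ 2 : ℝ))) ν := by
    have (j : Fin 2) := ((hk.integrable_mul j hvv).const_mul (I * G j)).sub
      ((hkk j j).const_mul (((p.σsq j + p.Vsq j) / 2 : ℝ) : ℂ))
    refine ((this 0).add (this 1)).congr (Eventually.of_forall fun t => ?_)
    simp only [Fin.sum_univ_two, Pi.add_apply, Pi.sub_apply]
    push_cast
    ring
  have i6 (j : Fin 2) : Integrable (fun t => (I * k j t * (G j * ‖v t‖ ^ 2
      + (I * Complex.exp (I * p.ψ j) * conj (u t) * v t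
        + conj (I * Complex.exp (I * p.ψ j) * conj (u t) * v t)))
      - p.κ₂ j / (2 * p.κ₃ j ^ 2) * (k j t) ^ 2 * ‖v t‖ ^ 2)) ν := by
    have a1 := (hvv.const_mul (G j : ℂ)).add ((huv.const_mul (I * Complex.exp (I * p.ψ j))).add
      ((integrable_mul_conj hv hu).const_mul (conj (I * Complex.exp (I * p.ψ j)))))
    refine (((hk.integrable_mul j a1).const_mul I).sub
      ((hkk j j).const_mul ((p.κ₂ j : ℂ) / (2 * p.κ₃ j ^ 2)))).congr
      (Eventually.of_forall fun t => ?_)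
    simp only [Pi.add_apply, Pi.sub_apply, map_mul, conj_conj]
    ring
  have hG (j : Fin 2) : (p.κ₂ j : ℂ) / (2 * p.κ₃ j ^ 2) =
      (1 + p.G₃ j + p.σsq j + p.Vsq j) / 2 := by
    rw [mul_comm, ← div_div]
    congr 1
    exact_mod_cast (p.one_add_G₃_add j).symm
  have hcomb {a b c d e : ℝ → ℂ} (ha : Integrable a ν) (hb : Integrable b ν) (hc : Integrable c ν)
      (hd : Integrable d ν) (he : Integrable e ν) :
      (∫ t, a t ∂ν) + ((∫ t, b t ∂ν) + (∫ t, c t ∂ν) - ∫ t, d t ∂ν) + ∫ t, e t ∂ν =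
        ∫ t, (a t + (b t + c t - d t) + e t) ∂ν := by
    rw [integral_add (f := fun t => a t + (b t + c t - d t)) (ha.add ((hb.add hc).sub hd)) he,
      integral_add (g := fun t => b t + c t - d t) ha ((hb.add hc).sub hd),
      integral_sub (f := fun t => b t + c t) (hb.add hc) hd, integral_add hb hc]
  calc _ = (∫ t, ((-(1 / 2) * (∑ j, ∑ i, k j t * p.Ξ j i * k i t) * ‖v t‖ ^ 2 : ℝ) : ℂ) ∂ν)
        + ((∫ t, -(1 / 2) * ((‖g t‖ ^ 2 : ℝ) : ℂ) ∂ν) + (∫ t, g t * conj (u t) ∂ν)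
          - ∫ t, u t * conj (g t) ∂ν)
        + ∫ t, ((‖v t‖ ^ 2 : ℝ) : ℂ) *
          ∑ j, (I * k j t * G j - ((p.σsq j + p.Vsq j) / 2 * k j t ^ 2 : ℝ)) ∂ν := by
        rw [integral_const_mul]
        ring
    _ = _ := by
        -- With one integral on each side, the claim becomes a pointwise identity of integrands.
        rw [← integral_finsetSum _ fun j _ => i6 j, hcomb i1 (i2.const_mul (-(1 / 2))) i3 i4 i5]
        refine integral_congr_ae (Eventually.of_forall fun t => ?_)
        have h1 := hnorm t
        have hg' : g t = -(∑ j, k j t * (p.ph j * v t)) := by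
          simp only [hg, Fin.sum_univ_two]
          linear_combination (k 0 t * (p.ph 0 * v t) + k 1 t * (p.ph 1 * v t)) * I_mul_I
        simp only [Fin.sum_univ_two, hg', hG, map_mul, conj_conj, conj_I] at h1 ⊢
        push_cast
        rw [h1]
        simp only [Circuit.Ξ, Circuit.ph]
        simp
        linear_combination (k 0 t * (u t * conj (v t) * conj (Complex.exp (I * p.ψ 0))
            - conj (u t) * v t * Complex.exp (I * p.ψ 0))
          + k 1 t * (u t * conj (v t) * conj (Complex.exp (I * p.ψ 1))
            - conj (u t) * v t * Complex.exp (I * p.ψ 1))) * I_mul_I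

end PhiZ

/-! ### Poisson formula for the counts and for `Z` -/

theorem setIntegral_counts (j : Fin 4) (c : Config) (f : ℝ → ℝ) {s : Set ℝ}
    (hs : MeasurableSet s) :
    ∫ t in s, f t ∂counts j c =
      ∑ l, if (c.2 l).1 = Fin.castAdd 4 j then s.indicator f (c.2 l).2 else 0 := by
  rw [← integral_indicator hs, counts, integral_finsetSum_measure]
  · refine Finset.sum_congr rfl fun l _ => ?_
    split_ifs
    · exact integral_dirac _ _
    · exact integral_zero_measure _
  · intro l _
    split_ifs
    · exact integrable_dirac (by simp)
    · exact integrable_zero_measure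

/-- The phase collected by a photon that arrives at the output `y`, for phase functions `θ j` of the
detectors. -/
def detPhase (T : ℝ) (θ : Fin 4 → ℝ → ℝ) (y : Fin 8 × ℝ) : ℝ :=
  ∑ j, if y.1 = Fin.castAdd 4 j then (Ioo 0 T).indicator (θ j) y.2 else 0

theorem detPhase_castAdd (T : ℝ) (θ : Fin 4 → ℝ → ℝ) (j : Fin 4) (t : ℝ) :
    detPhase T θ (Fin.castAdd 4 j, t) = (Ioo 0 T).indicator (θ j) t := by
  simp only [detPhase, (Fin.castAdd_injective 4 4).eq_iff]
  simp

/-- Photons in the loss ports are not observed, so they carry no phase and disappear from the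
exponent. -/
theorem detPhase_natAdd (T : ℝ) (θ : Fin 4 → ℝ → ℝ) (j : Fin 4) (t : ℝ) :
    detPhase T θ (Fin.natAdd 4 j, t) = 0 := by
  refine Finset.sum_eq_zero fun i _ => if_neg fun h => ?_
  have := congrArg Fin.val h
  simp at this
  omega

theorem measurable_detPhase (T : ℝ) {θ : Fin 4 → ℝ → ℝ} (hθ : ∀ j, Measurable (θ j)) :
    Measurable (detPhase T θ) := by
  unfold detPhase
  refine Finset.measurable_fun_sum _ fun j _ => Measurable.ite ?_ ?_ measurable_const
  · exact measurable_fst (measurableSet_singleton _)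
  · exact ((hθ j).indicator measurableSet_Ioo).comp measurable_snd

theorem memLp_inputAmp {T : ℝ} {u v : ℝ → ℂ} (hu : MemLp u 2 (volume.restrict (Ioo 0 T)))
    (hv : MemLp v 2 (volume.restrict (Ioo 0 T))) : MemLp (inputAmp T u v) 2 portMeasure := by
  refine memLp_portMeasure fun i => ?_
  simp only [inputAmp]
  split_ifs
  · exact memLp_window hu
  · exact memLp_window hv
  · exact MemLp.zero'

/-- For given amplitudes the detected photons form Poisson processes. -/
theorem integral_photonLaw_detPhase (p : Circuit) {T : ℝ} {u v : ℝ → ℂ}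
    (hu : MemLp u 2 (volume.restrict (Ioo 0 T))) (hv : MemLp v 2 (volume.restrict (Ioo 0 T)))
    {θ : Fin 4 → ℝ → ℝ} (hθ : ∀ j, Measurable (θ j)) :
    ∫ x, Complex.exp (I * ((∑ l, detPhase T θ (x.2 l) : ℝ) : ℂ))
      ∂photonLaw p.scattering (inputVec T u v) =
    Complex.exp (∑ j, ∫ t in Ioo 0 T, (Complex.exp (I * θ j t) - 1) * intensity p j u v t) := by
  set S := p.scattering
  have hA := memLp_inputAmp hu hv
  set A := inputAmp T u v with hAdef
  set U : Lp ℂ 2 portMeasure := toL2 portMeasure A with hU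
  have hUA : U =ᵐ[portMeasure] A := by
    rw [hU, toL2_eq hA]
    exact hA.coeFn_toLp
  have hVA := outputAmp_congr (S := S) hUA
  have hVi : Integrable (fun y => ((‖outputAmp S A y‖ ^ 2 : ℝ) : ℂ)) portMeasure := by
    have h : Integrable (fun y => ‖outputAmp S A y‖ ^ 2) portMeasure := by
      refine (integrable_norm_sq_outputAmp S U).congr ?_
      filter_upwards [hVA] with y hy
      rw [hy]
    exact h.ofReal
  set c : Fin 8 × ℝ → ℂ := fun y => Complex.exp (I * detPhase T θ y) with hcdef
  have hc : Measurable c := by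
    have := measurable_detPhase T hθ
    fun_prop
  have hc1 (y) : ‖c y‖ = 1 := norm_exp_I_mul_ofReal _
  have hcV : Integrable (fun y => c y * (‖outputAmp S A y‖ ^ 2 : ℝ)) portMeasure :=
    hVi.bdd_mul (c := 1) hc.aestronglyMeasurable (Eventually.of_forall fun y => (hc1 y).le)
  have h1 : (fun x : Config => Complex.exp (I * ((∑ l, detPhase T θ (x.2 l) : ℝ) : ℂ))) =
      fun x => ∏ l, c (x.2 l) := by
    funext x
    rw [← Complex.exp_sum, ← Finset.mul_sum]
    push_cast
    rfl
  -- Unitarity, applied at each time, turns the normalization into the total output intensity and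
  -- yields the `-1` in `c - 1`.
  have hnorm : ((‖U‖ ^ 2 : ℝ) : ℂ) = ∫ y, ((‖outputAmp S A y‖ ^ 2 : ℝ) : ℂ) ∂portMeasure := by
    have hAi : Integrable (fun y => ((‖A y‖ ^ 2 : ℝ) : ℂ)) portMeasure :=
      ((memLp_two_iff_integrable_sq_norm hA.aestronglyMeasurable).1 hA).ofReal
    rw [hU, norm_sq_toL2 hA, ← integral_complex_ofReal, integral_portMeasure hAi,
      integral_portMeasure hVi, ← integral_finsetSum _ fun i _ => integrable_portMeasure_iff.1 hAi i,
      ← integral_finsetSum _ fun i _ => integrable_portMeasure_iff.1 hVi i]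
    refine integral_congr_ae (Eventually.of_forall fun t => ?_)
    have := p.sum_norm_sq_scattering fun i => A (i, t)
    simp only [← ofReal_sum]
    rw [← this]
    rfl
  have h2 : ∫ y, c y * (‖outputAmp S U y‖ ^ 2 : ℝ) ∂portMeasure =
      ∫ y, c y * (‖outputAmp S A y‖ ^ 2 : ℝ) ∂portMeasure := by
    refine integral_congr_ae ?_
    filter_upwards [hVA] with y hy
    rw [hy]
  have hi : Integrable (fun y => c y * (‖outputAmp S A y‖ ^ 2 : ℝ)
      - ((‖outputAmp S A y‖ ^ 2 : ℝ) : ℂ)) portMeasure := hcV.sub hVi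
  rw [h1]
  refine (integral_photonLaw S U hc hc1).trans ?_
  rw [h2, hnorm, ← integral_sub hcV hVi, integral_portMeasure hi]
  congr 1
  -- The eight ports split into the four detectors and the four loss ports.
  rw [show (∑ i : Fin 8, ∫ t, (c (i, t) * (‖outputAmp S A (i, t)‖ ^ 2 : ℝ)
      - ((‖outputAmp S A (i, t)‖ ^ 2 : ℝ) : ℂ))) = _ from Fin.sum_univ_add (a := 4) (b := 4) _]
  rw [Finset.sum_eq_zero (s := (Finset.univ : Finset (Fin 4)))
    (f := fun i => ∫ t, (c (Fin.natAdd 4 i, t) * (‖outputAmp S A (Fin.natAdd 4 i, t)‖ ^ 2 : ℝ)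
      - ((‖outputAmp S A (Fin.natAdd 4 i, t)‖ ^ 2 : ℝ) : ℂ))), add_zero]
  · refine Finset.sum_congr rfl fun j _ => ?_
    rw [← integral_indicator measurableSet_Ioo]
    refine integral_congr_ae (Eventually.of_forall fun t => ?_)
    simp only [hcdef, detPhase_castAdd]
    by_cases ht : t ∈ Ioo 0 T
    · have hV : outputAmp S A (Fin.castAdd 4 j, t) =
          S (Fin.castAdd 4 j) 0 * u t + S (Fin.castAdd 4 j) 2 * v t := by
        simp [outputAmp, hAdef, inputAmp, window, ht, Fin.sum_univ_eight]
      rw [indicator_of_mem ht, indicator_of_mem ht, hV, p.norm_sq_scattering, intensity]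
      ring
    -- Outside the window the phase is zero, so the factor `c - 1` already vanishes.
    · rw [indicator_of_notMem ht, indicator_of_notMem ht]
      simp
  · intro j _
    simp only [hcdef, detPhase_natAdd]
    simp

theorem condPhiN_eq (p : Circuit) {T : ℝ} {u v : ℝ → ℂ}
    (hu : MemLp u 2 (volume.restrict (Ioo 0 T))) (hv : MemLp v 2 (volume.restrict (Ioo 0 T)))
    {k : Fin 4 → ℝ → ℝ} (hk : ∀ j, Measurable (k j)) :
    condPhiN p T k u v = Complex.exp (∑ j, ∫ t in Ioo 0 T,
      (Complex.exp (I * k j t) - 1) * intensity p j u v t) := by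
  rw [← integral_photonLaw_detPhase p hu hv hk, condPhiN]
  congr 1
  funext x
  congr 3
  simp only [setIntegral_counts _ _ _ measurableSet_Ioo, detPhase]
  exact Finset.sum_comm

/-- The phase functions of the four detectors for the weights `K j` of the balanced pairs. -/
def pairPhase (p : Circuit) (a : Fin 2 → ℝ) (K : Fin 2 → ℝ → ℝ) : Fin 4 → ℝ → ℝ := fun j t =>
  detSign j * p.ξ j * (a (phaseIdx j) * K (phaseIdx j) t)

theorem measurable_pairPhase (p : Circuit) (a : Fin 2 → ℝ) {K : Fin 2 → ℝ → ℝ}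
    (hK : ∀ j, Measurable (K j)) (j : Fin 4) : Measurable (pairPhase p a K j) :=
  ((hK _).const_mul _).const_mul _

theorem detPhase_pairPhase (p : Circuit) (T : ℝ) (a : Fin 2 → ℝ) (K : Fin 2 → ℝ → ℝ)
    (y : Fin 8 × ℝ) : detPhase T (pairPhase p a K) y = ∑ j, a j *
      (p.ξ (plusDet j) * (if y.1 = Fin.castAdd 4 (plusDet j) then (Ioo 0 T).indicator (K j) y.2 else 0)
      - p.ξ (minusDet j) *
        if y.1 = Fin.castAdd 4 (minusDet j) then (Ioo 0 T).indicator (K j) y.2 else 0) := by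
  let E (i : Fin 4) (j : Fin 2) : ℝ :=
    if y.1 = Fin.castAdd 4 i then (Ioo 0 T).indicator (K j) y.2 else 0
  have h : detPhase T (pairPhase p a K) y =
      ∑ i, detSign i * p.ξ i * (a (phaseIdx i) * E i (phaseIdx i)) := by
    refine Finset.sum_congr rfl fun i _ => ?_
    simp only [E]
    split_ifs
    · by_cases ht : y.2 ∈ Ioo 0 T <;> simp [ht, pairPhase]
    · simp
  rw [h]
  change _ = ∑ j, a j * (p.ξ (plusDet j) * E (plusDet j) j - p.ξ (minusDet j) * E (minusDet j) j)
  clear_value E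
  simp only [Fin.sum_univ_two, Fin.sum_univ_four, plusDet, minusDet, detSign, phaseIdx,
    Matrix.cons_val_zero, Matrix.cons_val_one, Matrix.cons_val]
  ring

theorem sum_detPhase_pairPhase (p : Circuit) (T : ℝ) (a : Fin 2 → ℝ) (K : Fin 2 → ℝ → ℝ)
    (c : Config) : ∑ l, detPhase T (pairPhase p a K) (c.2 l) = ∑ j, a j *
      (p.ξ (plusDet j) * (∫ s in Ioo 0 T, K j s ∂counts (plusDet j) c)
        - p.ξ (minusDet j) * ∫ s in Ioo 0 T, K j s ∂counts (minusDet j) c) := by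
  simp only [detPhase_pairPhase, setIntegral_counts _ _ _ measurableSet_Ioo]
  rw [Finset.sum_comm]
  simp only [← Finset.mul_sum, Finset.sum_sub_distrib]

/-- The weight is written `1 / κ₃ / L`, a convergent quantity divided by `L`, which is the shape
required by `tendsto_strong_oscillator`. -/
theorem condPhiZ_eq (p : Circuit) {T : ℝ} (L : ℝ) {u v : ℝ → ℂ}
    (hu : MemLp u 2 (volume.restrict (Ioo 0 T))) (hv : MemLp v 2 (volume.restrict (Ioo 0 T)))
    {k : Fin 2 → ℝ → ℝ} (hk : ∀ j, Measurable (k j)) :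
    condPhiZ p T L k u v = Complex.exp (∑ j, ∫ t in Ioo 0 T,
      (Complex.exp (I * pairPhase p (fun j => 1 / p.κ₃ j / L) k j t) - 1) *
        intensity p j u (fun t => L * v t) t) := by
  rw [← integral_photonLaw_detPhase p hu (hv.const_mul (L : ℂ)) (measurable_pairPhase p _ hk),
    condPhiZ]
  congr 1
  funext x
  congr 3
  rw [sum_detPhase_pairPhase]
  refine Finset.sum_congr rfl fun j _ => ?_
  rw [intZ, div_div, mul_comm (p.κ₃ j), one_div_mul_eq_div]

/-! ### Smoothed detector outputs -/

/-- The response `∫_t^T h(s-t) k_j(s) ds` of the detectors, without the factor `κ_{j3}`. -/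
def response (h : ℝ → ℝ) (T : ℝ) (k : Fin 2 → ℝ → ℝ) : Fin 2 → ℝ → ℝ := fun j t =>
  ∫ s in Ioo t T, h (s - t) * k j s

section Response

variable {h : ℝ → ℝ} {T : ℝ}

theorem integrableOn_shift (hi : IntegrableOn h (Ioi 0)) (t : ℝ) : IntegrableOn (fun s => h (s - t)) (Ioi t) := by
  have := (measurePreserving_sub_right volume t).integrableOn_comp_preimage
    (measurableEmbedding_subRight t) (f := h) (s := Ioi 0)
  rw [show (fun s => s - t) ⁻¹' Ioi 0 = Ioi t by ext s; simp] at this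
  exact this.2 hi

/-- The bound is the supremum of `k` times `∫ h`. The smoothed functions are thus again test
functions, and `X / L` needs no limit theorem of its own. -/
theorem isTest_response (hm : Measurable h) (hpos : ∀ t, 0 ≤ h t) (hi : IntegrableOn h (Ioi 0))
    {k : Fin 2 → ℝ → ℝ} (hk : IsTest k) : IsTest (response h T k) := by
  intro j
  obtain ⟨hkm, C, hC⟩ := hk j
  have hC0 : 0 ≤ C := (abs_nonneg _).trans (hC 0)
  constructor
  -- An indicator on the plane replaces the moving domain `(t, T)`, so that measurability of
  -- parametric integrals applies.
  · have h1 : response h T k j = fun t => ∫ s, {x : ℝ × ℝ | x.1 < x.2 ∧ x.2 < T}.indicator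
        (fun x => h (x.2 - x.1) * k j x.2) (t, s) := by
      funext t
      rw [response, ← integral_indicator measurableSet_Ioo]
      rfl
    rw [h1]
    refine (StronglyMeasurable.integral_prod_right ?_).measurable
    refine StronglyMeasurable.indicator ?_ ?_
    · exact ((hm.comp (measurable_snd.sub measurable_fst)).mul
        (hkm.comp measurable_snd)).stronglyMeasurable
    · exact (measurableSet_lt measurable_fst measurable_snd).inter
        (measurableSet_lt measurable_snd measurable_const)
  · refine ⟨(∫ s in Ioi 0, h s) * C, fun t => ?_⟩
    have h2 := integrableOn_shift hi t
    have h3 : ∫ s in Ioi t, h (s - t) = ∫ s in Ioi 0, h s := by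
      have := (measurePreserving_sub_right volume t).setIntegral_preimage_emb
        (measurableEmbedding_subRight t) h (Ioi 0)
      rw [show (fun s => s - t) ⁻¹' Ioi 0 = Ioi t by ext s; simp] at this
      exact this
    calc |response h T k j t| ≤ ∫ s in Ioo t T, h (s - t) * C := by
          rw [← Real.norm_eq_abs]
          refine norm_integral_le_of_norm_le ((h2.mono_set Ioo_subset_Ioi_self).mul_const C)
            (Eventually.of_forall fun s => ?_)
          rw [norm_mul, Real.norm_of_nonneg (hpos _)]
          exact mul_le_mul_of_nonneg_left (hC s) (hpos _)
      _ ≤ ∫ s in Ioi t, h (s - t) * C :=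
          setIntegral_mono_set (h2.mul_const C)
            (Eventually.of_forall fun s => mul_nonneg (hpos _) hC0)
            (Ioo_subset_Ioi_self : Ioo t T ⊆ Ioi t).eventuallyLE
      _ = _ := by rw [integral_mul_const, h3]

theorem integrable_response (hi : IntegrableOn h (Ioi 0))
    {k : Fin 2 → ℝ → ℝ} (hk : IsTest k) (j : Fin 2) (t : ℝ) :
    IntegrableOn (fun s => k j s * h (s - t)) (Ioi t) := by
  obtain ⟨hkm, C, hC⟩ := hk j
  exact (integrableOn_shift hi t).bdd_mul (c := C) hkm.aestronglyMeasurable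
    (Eventually.of_forall hC)

/-- The smoothed output of a detector, integrated against a test function. -/
theorem setIntegral_smoothed_counts (hi : IntegrableOn h (Ioi 0))
    {k : Fin 2 → ℝ → ℝ} (hk : IsTest k) (j : Fin 2) (i : Fin 4) (c : Config) :
    IntegrableOn (fun t => k j t * ∫ s in Ioc 0 t, h (t - s) ∂counts i c) (Ioo 0 T) ∧
    ∫ t in Ioo 0 T, k j t * ∫ s in Ioc 0 t, h (t - s) ∂counts i c =
      ∫ s in Ioo 0 T, response h T k j s ∂counts i c := by
  -- The contribution of a single photon arriving at time `r`; the general case is a finite sum of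
  -- these.
  have key (r : ℝ) : Integrable (fun t => k j t * (Ioc 0 t).indicator (fun s => h (t - s)) r)
        (volume.restrict (Ioo 0 T)) ∧
      ∫ t in Ioo 0 T, k j t * (Ioc 0 t).indicator (fun s => h (t - s)) r =
        (Ioo 0 T).indicator (response h T k j) r := by
    -- `r ∈ (0, t]` means `0 < r` and `r ≤ t`. Passing to `r < t` changes only the null set `t = r`
    -- and gives the open interval used in `response`.
    have hae : (fun t => k j t * (Ioc 0 t).indicator (fun s => h (t - s)) r)
        =ᵐ[volume.restrict (Ioo 0 T)]
        (Ioi r).indicator fun t => (Ioi 0).indicator (fun s => k j t * h (t - s)) r := by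
      refine ae_restrict_of_ae ?_
      have : ∀ᵐ t : ℝ, t ≠ r := by simp [ae_iff, measure_singleton]
      filter_upwards [this] with t ht
      by_cases h0 : 0 < r <;> by_cases h1 : r < t
      · simp [h0, h1, h1.le]
      · simp [h0, h1, show ¬ r ≤ t from fun h => h1 (lt_of_le_of_ne h ht.symm)]
      · simp [h0, h1]
      · simp [h0, h1]
    have hint : Integrable ((Ioi r).indicator fun t => (Ioi 0).indicator
        (fun s => k j t * h (t - s)) r) (volume : Measure ℝ) := by
      rw [integrable_indicator_iff measurableSet_Ioi]
      by_cases h0 : 0 < r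
      · simp only [indicator_of_mem (show r ∈ Ioi (0 : ℝ) from h0)]
        exact integrable_response hi hk j r
      · simp only [indicator_of_notMem (show r ∉ Ioi (0 : ℝ) from h0)]
        exact integrable_zero _ _ _
    refine ⟨hint.integrableOn.congr hae.symm, ?_⟩
    rw [integral_congr_ae hae, integral_indicator measurableSet_Ioi,
      Measure.restrict_restrict measurableSet_Ioi]
    by_cases h0 : 0 < r
    · simp only [indicator_of_mem (show r ∈ Ioi (0 : ℝ) from h0)]
      by_cases h1 : r < T
      · rw [indicator_of_mem (show r ∈ Ioo 0 T from ⟨h0, h1⟩), response,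
          show Ioi r ∩ Ioo 0 T = Ioo r T by
            ext t
            simp only [mem_inter_iff, mem_Ioi, mem_Ioo]
            exact ⟨fun h => ⟨h.1, h.2.2⟩, fun h => ⟨h.1, h0.trans h.1, h.2⟩⟩]
        simp only [mul_comm]
      · rw [indicator_of_notMem fun h : r ∈ Ioo 0 T => h1 h.2,
          show Ioi r ∩ Ioo 0 T = ∅ by
            ext t
            simp only [mem_inter_iff, mem_Ioi, mem_Ioo, mem_empty_iff_false, iff_false]
            exact fun h => h1 (h.1.trans h.2.2)]
        simp
    · rw [indicator_of_notMem fun h : r ∈ Ioo 0 T => h0 h.1]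
      simp only [indicator_of_notMem (show r ∉ Ioi (0 : ℝ) from h0)]
      simp
  have hsum : (fun t => k j t * ∫ s in Ioc 0 t, h (t - s) ∂counts i c) = fun t =>
      ∑ l, if (c.2 l).1 = Fin.castAdd 4 i then
        k j t * (Ioc 0 t).indicator (fun s => h (t - s)) (c.2 l).2 else 0 := by
    funext t
    rw [setIntegral_counts _ _ _ measurableSet_Ioc, Finset.mul_sum]
    simp only [mul_ite, mul_zero]
  have hl (l : Fin c.1) : Integrable (fun t => if (c.2 l).1 = Fin.castAdd 4 i then
      k j t * (Ioc 0 t).indicator (fun s => h (t - s)) (c.2 l).2 else 0)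
      (volume.restrict (Ioo 0 T)) := by
    split_ifs
    · exact (key _).1
    · exact integrable_zero _ _ _
  rw [hsum]
  refine ⟨integrable_finsetSum _ fun l _ => hl l, ?_⟩
  rw [integral_finsetSum _ fun l _ => hl l, setIntegral_counts _ _ _ measurableSet_Ioo]
  refine Finset.sum_congr rfl fun l _ => ?_
  split_ifs
  · exact (key _).2
  · simp

theorem condPhiY_eq (p : Circuit) (hm : Measurable h) (hpos : ∀ t, 0 ≤ h t)
    (hi : IntegrableOn h (Ioi 0)) (L : ℝ) {u v : ℝ → ℂ}
    (hu : MemLp u 2 (volume.restrict (Ioo 0 T))) (hv : MemLp v 2 (volume.restrict (Ioo 0 T)))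
    {k : Fin 2 → ℝ → ℝ} (hk : IsTest k) :
    condPhiY p h T L k u v = Complex.exp (∑ j, ∫ t in Ioo 0 T,
      (Complex.exp (I * pairPhase p (fun _ => 1 / L) (response h T k) j t) - 1) *
        intensity p j u (fun t => L * v t) t) := by
  rw [← integral_photonLaw_detPhase p hu (hv.const_mul (L : ℂ))
    (measurable_pairPhase p _ fun j => (isTest_response hm hpos hi hk j).1), condPhiY]
  congr 1
  funext x
  have e : ∑ l, detPhase T (pairPhase p (fun _ => 1 / L) (response h T k)) (x.2 l) =
      1 / L * ∑ j, ∫ t in Ioo 0 T, k j t * outputX p h j x t := by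
    rw [sum_detPhase_pairPhase, ← Finset.mul_sum]
    congr 1
    refine Finset.sum_congr rfl fun j _ => ?_
    have h1 := setIntegral_smoothed_counts (T := T) hi hk j (plusDet j) x
    have h2 := setIntegral_smoothed_counts (T := T) hi hk j (minusDet j) x
    rw [← h1.2, ← h2.2, ← integral_const_mul, ← integral_const_mul,
      ← integral_sub (h1.1.const_mul _) (h2.1.const_mul _)]
    refine integral_congr_ae (Eventually.of_forall fun t => ?_)
    simp only [outputX]
    ring
  rw [e]
  congr 1
  push_cast
  ring

end Response

/-! ### Asymptotics of phases of order `1 / L` -/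

section PhaseExpansion

theorem norm_exp_I_mul_sub_one_sub_le {x : ℝ} (hx : |x| ≤ 1) :
    ‖Complex.exp (I * x) - 1 - I * x‖ ≤ x ^ 2 := by
  have h : ‖I * (x : ℂ)‖ = |x| := by simp
  have := Complex.norm_exp_sub_one_sub_id_le (x := I * x) (by rwa [h])
  rwa [h, sq_abs] at this

theorem tendsto_div_atTop_zero {x : ℝ → ℝ} {y : ℝ} (hx : Tendsto x atTop (𝓝 y)) :
    Tendsto (fun L => x L / L) atTop (𝓝 0) := hx.div_atTop tendsto_id

theorem eventually_abs_div_le_one {x : ℝ → ℝ} {y : ℝ} (hx : Tendsto x atTop (𝓝 y)) :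
    ∀ᶠ L in atTop, |x L / L| ≤ 1 := by
  have := (tendsto_div_atTop_zero hx).abs
  rw [abs_zero] at this
  exact this.eventually_le_const one_pos

/-- The third-order Taylor remainder, multiplied by `L²`, is at most `|x L|³ / L`. The numerator `x`
varies with `L` because the circuit parameters do. -/
theorem tendsto_sq_mul_exp {x : ℝ → ℝ} {y : ℝ} (hx : Tendsto x atTop (𝓝 y)) :
    Tendsto (fun L : ℝ => (L : ℂ) ^ 2 *
      (Complex.exp (I * (x L / L : ℝ)) - 1 - I * (x L / L : ℝ))) atTop (𝓝 (-(y : ℂ) ^ 2 / 2)) := by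
  have h1 : Tendsto (fun L => -(x L : ℂ) ^ 2 / 2) atTop (𝓝 (-(y : ℂ) ^ 2 / 2)) :=
    (((continuous_ofReal.tendsto y).comp hx).pow 2).neg.div_const 2
  have h0 : Tendsto (fun L => |x L| ^ 3 / L) atTop (𝓝 0) := (hx.abs.pow 3).div_atTop tendsto_id
  have h2 : Tendsto (fun L : ℝ => (L : ℂ) ^ 2 *
      (Complex.exp (I * (x L / L : ℝ)) - 1 - I * (x L / L : ℝ)) - -(x L : ℂ) ^ 2 / 2)
      atTop (𝓝 0) := by
    refine squeeze_zero_norm' ?_ h0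
    filter_upwards [eventually_abs_div_le_one hx, eventually_gt_atTop 0] with L h1 hL
    have hn : ‖I * ((x L / L : ℝ) : ℂ)‖ = |x L / L| := by
      rw [norm_mul, norm_I, one_mul, Complex.norm_real, Real.norm_eq_abs]
    have hb := Complex.exp_bound (x := I * (x L / L : ℝ)) (by rwa [hn]) (n := 3) (by norm_num)
    rw [hn] at hb
    simp only [Finset.sum_range_succ, Finset.sum_range_zero, Nat.factorial, Nat.cast_one] at hb
    have hL' : (L : ℂ) ≠ 0 := by exact_mod_cast hL.ne'
    have e : (L : ℂ) ^ 2 * (Complex.exp (I * (x L / L : ℝ)) - 1 - I * (x L / L : ℝ))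
        - -(x L : ℂ) ^ 2 / 2 = (L : ℂ) ^ 2 * (Complex.exp (I * (x L / L : ℝ)) -
          (1 + I * (x L / L : ℝ) - (x L / L : ℝ) ^ 2 / 2)) := by
      push_cast
      field_simp
      ring
    -- The Taylor polynomial in the shape that `Complex.exp_bound` takes after unfolding the sum and
    -- the factorials.
    have e2 : (1 + I * (x L / L : ℝ) - ((x L / L : ℝ) : ℂ) ^ 2 / 2) =
        0 + (I * (x L / L : ℝ)) ^ 0 / 1 + (I * (x L / L : ℝ)) ^ 1 / ((0 + 1) * 1 : ℕ)
          + (I * (x L / L : ℝ)) ^ 2 / ((1 + 1) * ((0 + 1) * 1) : ℕ) := by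
      push_cast
      linear_combination (-((x L : ℂ) / L) ^ 2 / 2) * I_sq
    rw [e, e2, norm_mul, norm_pow, Complex.norm_real, Real.norm_of_nonneg hL.le]
    calc L ^ 2 * _ ≤ L ^ 2 * (|x L / L| ^ 3 * 1) := by
          -- The constant in `Complex.exp_bound` is `4 / (3! * 3)`, which is below `1`.
          refine mul_le_mul_of_nonneg_left (hb.trans ?_) (by positivity)
          refine mul_le_mul_of_nonneg_left ?_ (by positivity)
          norm_num
      _ = |x L| ^ 3 / L := by
          rw [abs_div, abs_of_pos hL]
          field_simp
  simpa using h2.add h1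

/-- Dividing the second-order limit by `L` kills it, and only the linear term `i x` survives. -/
theorem tendsto_mul_exp {x : ℝ → ℝ} {y : ℝ} (hx : Tendsto x atTop (𝓝 y)) :
    Tendsto (fun L : ℝ => (L : ℂ) * (Complex.exp (I * (x L / L : ℝ)) - 1)) atTop (𝓝 (I * y)) := by
  have h1 := (tendsto_sq_mul_exp hx).mul
    ((continuous_ofReal.tendsto 0).comp (tendsto_inv_atTop_zero (𝕜 := ℝ)))
  have h2 : Tendsto (fun L => I * (x L : ℂ)) atTop (𝓝 (I * y)) :=
    ((continuous_ofReal.tendsto y).comp hx).const_mul I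
  have h3 := h1.add h2
  simp only [ofReal_zero, mul_zero, zero_add] at h3
  refine h3.congr' ?_
  filter_upwards [eventually_gt_atTop 0] with L hL
  have hL' : (L : ℂ) ≠ 0 := by exact_mod_cast hL.ne'
  simp only [Function.comp_apply]
  push_cast
  field_simp
  ring

theorem tendsto_exp_sub_one {x : ℝ → ℝ} {y : ℝ} (hx : Tendsto x atTop (𝓝 y)) :
    Tendsto (fun L : ℝ => Complex.exp (I * (x L / L : ℝ)) - 1) atTop (𝓝 0) := by
  have h1 : Tendsto (fun L : ℝ => I * ((x L / L : ℝ) : ℂ)) atTop (𝓝 (I * (0 : ℝ))) :=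
    ((continuous_ofReal.tendsto 0).comp (tendsto_div_atTop_zero hx)).const_mul I
  have := ((Complex.continuous_exp.tendsto _).comp h1).sub_const 1
  simpa using this

variable {ν : Measure ℝ} {K : ℝ → ℝ} {c : ℝ → ℝ} {c₀ : ℝ} {f : ℝ → ℂ}

/-- A bound uniform in both `t` and large `L`, from which the dominating functions below are built.
-/
theorem eventually_abs_mul_le (hK : ∃ C, ∀ t, |K t| ≤ C) (hc : Tendsto c atTop (𝓝 c₀)) :
    ∃ M, 0 ≤ M ∧ ∀ᶠ L in atTop, ∀ t, |c L * K t| ≤ M := by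
  obtain ⟨C, hC⟩ := hK
  have hC0 : 0 ≤ C := (abs_nonneg _).trans (hC 0)
  refine ⟨(|c₀| + 1) * C, by positivity, ?_⟩
  filter_upwards [hc.abs.eventually_le_const (lt_add_one _)] with L hL t
  rw [abs_mul]
  exact mul_le_mul hL (hC t) (abs_nonneg _) (by positivity)

theorem tendsto_integral_exp_sub_one (hKm : Measurable K)
    (hc : Tendsto c atTop (𝓝 c₀)) (hf : Integrable f ν) :
    Tendsto (fun L : ℝ => ∫ t, (Complex.exp (I * (c L * K t / L : ℝ)) - 1) * f t ∂ν) atTop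
      (𝓝 0) := by
  have : Tendsto (fun L : ℝ => ∫ t, (Complex.exp (I * (c L * K t / L : ℝ)) - 1) * f t ∂ν) atTop
      (𝓝 (∫ t, 0 * f t ∂ν)) := by
    refine tendsto_integral_filter_of_dominated_convergence (fun t => 2 * ‖f t‖) ?_ ?_
      (hf.norm.const_mul 2) ?_
    · refine Eventually.of_forall fun L => AEStronglyMeasurable.mul ?_ hf.aestronglyMeasurable
      exact Measurable.aestronglyMeasurable (by fun_prop)
    · refine Eventually.of_forall fun L => Eventually.of_forall fun t => ?_
      rw [norm_mul]
      refine mul_le_mul_of_nonneg_right ?_ (norm_nonneg _)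
      refine (norm_sub_le _ _).trans ?_
      rw [norm_exp_I_mul_ofReal, norm_one]
      norm_num
    · refine Eventually.of_forall fun t => ?_
      exact (tendsto_exp_sub_one (hc.mul_const (K t))).mul_const _
  simpa using this

theorem tendsto_integral_mul_exp (hKm : Measurable K) (hK : ∃ C, ∀ t, |K t| ≤ C)
    (hc : Tendsto c atTop (𝓝 c₀)) (hf : Integrable f ν) :
    Tendsto (fun L : ℝ => ∫ t, L * (Complex.exp (I * (c L * K t / L : ℝ)) - 1) * f t ∂ν) atTop
      (𝓝 (I * c₀ * ∫ t, K t * f t ∂ν)) := by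
  obtain ⟨M, hM0, hM⟩ := eventually_abs_mul_le hK hc
  rw [← integral_const_mul]
  refine tendsto_integral_filter_of_dominated_convergence (fun t => M * ‖f t‖) ?_ ?_
    (hf.norm.const_mul M) ?_
  · refine Eventually.of_forall fun L => AEStronglyMeasurable.mul ?_ hf.aestronglyMeasurable
    exact Measurable.aestronglyMeasurable (by fun_prop)
  · filter_upwards [hM, eventually_gt_atTop 0] with L hML hL
    refine Eventually.of_forall fun t => ?_
    rw [norm_mul, norm_mul, Complex.norm_real, Real.norm_of_nonneg hL.le]
    refine mul_le_mul_of_nonneg_right ?_ (norm_nonneg _)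
    refine (mul_le_mul_of_nonneg_left Real.norm_exp_I_mul_ofReal_sub_one_le hL.le).trans ?_
    rw [Real.norm_eq_abs, abs_div, abs_of_pos hL, mul_div_cancel₀ _ hL.ne']
    exact hML t
  · refine Eventually.of_forall fun t => ?_
    have := (tendsto_mul_exp (hc.mul_const (K t))).mul_const (f t)
    refine this.trans_eq ?_
    push_cast
    ring_nf

/-- The linear term is removed because it diverges after multiplication by `L²`; what is left is
dominated by `M² ‖f‖`. -/
theorem tendsto_integral_sq_mul_exp (hKm : Measurable K) (hK : ∃ C, ∀ t, |K t| ≤ C)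
    (hc : Tendsto c atTop (𝓝 c₀)) (hf : Integrable f ν) :
    Tendsto (fun L : ℝ => ∫ t, (L : ℂ) ^ 2 * (Complex.exp (I * (c L * K t / L : ℝ)) - 1
      - I * (c L * K t / L : ℝ)) * f t ∂ν) atTop
      (𝓝 (-(c₀ : ℂ) ^ 2 / 2 * ∫ t, K t * (K t * f t) ∂ν)) := by
  obtain ⟨M, hM0, hM⟩ := eventually_abs_mul_le hK hc
  rw [← integral_const_mul]
  refine tendsto_integral_filter_of_dominated_convergence (fun t => M ^ 2 * ‖f t‖) ?_ ?_
    (hf.norm.const_mul (M ^ 2)) ?_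
  · refine Eventually.of_forall fun L => AEStronglyMeasurable.mul ?_ hf.aestronglyMeasurable
    exact Measurable.aestronglyMeasurable (by fun_prop)
  -- Taking `L ≥ M` brings every phase into `[-1, 1]`, where the quadratic bound holds.
  · filter_upwards [hM, eventually_gt_atTop 0, eventually_ge_atTop M] with L hML hL hLM
    refine Eventually.of_forall fun t => ?_
    rw [norm_mul, norm_mul, norm_pow, Complex.norm_real, Real.norm_of_nonneg hL.le]
    refine mul_le_mul_of_nonneg_right ?_ (norm_nonneg _)
    have h1 : |c L * K t / L| ≤ 1 := by
      rw [abs_div, abs_of_pos hL, div_le_one hL]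
      exact (hML t).trans hLM
    refine (mul_le_mul_of_nonneg_left (norm_exp_I_mul_sub_one_sub_le h1) (by positivity)).trans ?_
    rw [div_pow, mul_div_cancel₀ _ (by positivity), ← sq_abs]
    exact pow_le_pow_left₀ (abs_nonneg _) (hML t) 2
  · refine Eventually.of_forall fun t => ?_
    have := (tendsto_sq_mul_exp (hc.mul_const (K t))).mul_const (f t)
    refine this.trans_eq ?_
    push_cast
    ring_nf

end PhaseExpansion

/-! ### Expansion of the intensity and limits of the circuit constants -/

theorem detSign_mul_self (i : Fin 4) : detSign i * detSign i = 1 := by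
  fin_cases i <;> simp [detSign]

theorem Circuit.g₁_nonneg (p : Circuit) (i : Fin 4) : 0 ≤ p.g₁ i := by
  have hη := fun j => (p.η_pos j).le
  have hη' : ∀ j, 0 ≤ 1 - p.η j := fun j => by linarith [p.η_lt_one j]
  have hε := fun j => (p.ε_pos j).le
  fin_cases i <;> simp [g₁, hη, hη', hε, mul_nonneg]

theorem Circuit.g₂_nonneg (p : Circuit) (i : Fin 4) : 0 ≤ p.g₂ i := by
  have hη := fun j => (p.η_pos j).le
  have hη' : ∀ j, 0 ≤ 1 - p.η j := fun j => by linarith [p.η_lt_one j]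
  have hε := fun j => (p.ε_pos j).le
  fin_cases i <;> simp [g₂, hη, hη', hε, mul_nonneg]

/-- Expansion of the intensity in powers of the modulus of the local oscillator. -/
theorem intensity_eq (p : Circuit) (i : Fin 4) (u v : ℝ → ℂ) (L t : ℝ) :
    (intensity p i u (fun t => L * v t) t : ℂ) = p.g₁ i * (‖u t‖ : ℂ) ^ 2
      + L * (detSign i * (√(p.g₁ i) * √(p.g₂ i) : ℝ)) *
        (I * p.ph (phaseIdx i) * (conj (u t) * v t)
          - I * conj (p.ph (phaseIdx i)) * (conj (v t) * u t))
      + L ^ 2 * p.g₂ i * (‖v t‖ : ℂ) ^ 2 := by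
  have h1 : ((√(p.g₁ i) : ℝ) : ℂ) * (√(p.g₁ i) : ℝ) = p.g₁ i := by
    rw [← ofReal_mul, Real.mul_self_sqrt (p.g₁_nonneg i)]
  have h2 : ((√(p.g₂ i) : ℝ) : ℂ) * (√(p.g₂ i) : ℝ) = p.g₂ i := by
    rw [← ofReal_mul, Real.mul_self_sqrt (p.g₂_nonneg i)]
  have h3 : (detSign i : ℂ) * detSign i = 1 := by exact_mod_cast detSign_mul_self i
  have h4 := p.conj_ph_mul (phaseIdx i)
  rw [intensity, ofReal_pow, ← conj_mul' (u t), ← conj_mul' (v t), ← conj_mul']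
  simp only [map_add, map_mul, conj_ofReal, conj_I]
  rw [ofReal_mul]
  linear_combination conj (u t) * u t * h1 + L ^ 2 * conj (v t) * v t * (h2 +
    ((√(p.g₂ i) : ℝ) : ℂ) ^ 2 * (-(detSign i : ℂ) ^ 2 * conj (p.ph (phaseIdx i)) *
      p.ph (phaseIdx i) * I_mul_I + conj (p.ph (phaseIdx i)) * p.ph (phaseIdx i) * h3 + h4))

theorem tendsto_κ₃ {q : ℝ → Circuit} {p : Circuit} (hq : CircuitTendsto q p) (j : Fin 2) :
    Tendsto (fun L => (q L).κ₃ j) atTop (𝓝 (p.κ₃ j)) := by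
  have hη := tendsto_pi_nhds.1 hq.1
  have hε := tendsto_pi_nhds.1 hq.2.1
  have hξ := tendsto_pi_nhds.1 hq.2.2.1
  have hη' (i : Fin 4) : Tendsto (fun L => 1 - (q L).η i) atTop (𝓝 (1 - p.η i)) :=
    (hη i).const_sub 1
  fin_cases j
  · exact ((((hη 0).mul (hη 1)).mul (hη 2)).mul (hη' 2)).sqrt.mul
      (((hε 0).mul (hξ 0)).add ((hε 2).mul (hξ 2)))
  · exact ((((hη' 0).mul (hη' 1)).mul (hη 3)).mul (hη' 3)).sqrt.mul
      (((hε 1).mul (hξ 1)).add ((hε 3).mul (hξ 3)))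

theorem tendsto_g₁ {q : ℝ → Circuit} {p : Circuit} (hq : CircuitTendsto q p) (i : Fin 4) :
    Tendsto (fun L => (q L).g₁ i) atTop (𝓝 (p.g₁ i)) := by
  have hη := tendsto_pi_nhds.1 hq.1
  have hε := tendsto_pi_nhds.1 hq.2.1
  have hη' (i : Fin 4) : Tendsto (fun L => 1 - (q L).η i) atTop (𝓝 (1 - p.η i)) :=
    (hη i).const_sub 1
  fin_cases i
  · exact ((hη 0).mul (hη 2)).mul (hε 0)
  · exact ((hη' 0).mul (hη 3)).mul (hε 1)
  · exact ((hη 0).mul (hη' 2)).mul (hε 2)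
  · exact ((hη' 0).mul (hη' 3)).mul (hε 3)

theorem tendsto_g₂ {q : ℝ → Circuit} {p : Circuit} (hq : CircuitTendsto q p) (i : Fin 4) :
    Tendsto (fun L => (q L).g₂ i) atTop (𝓝 (p.g₂ i)) := by
  have hη := tendsto_pi_nhds.1 hq.1
  have hε := tendsto_pi_nhds.1 hq.2.1
  have hη' (i : Fin 4) : Tendsto (fun L => 1 - (q L).η i) atTop (𝓝 (1 - p.η i)) :=
    (hη i).const_sub 1
  fin_cases i
  · exact ((hη 1).mul (hη' 2)).mul (hε 0)
  · exact ((hη' 1).mul (hη' 3)).mul (hε 1)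
  · exact ((hη 1).mul (hη 2)).mul (hε 2)
  · exact ((hη' 1).mul (hη 3)).mul (hε 3)

theorem tendsto_ph {q : ℝ → Circuit} {p : Circuit} (hq : CircuitTendsto q p) (j : Fin 2) :
    Tendsto (fun L => (q L).ph j) atTop (𝓝 (p.ph j)) := by
  have hψ := tendsto_pi_nhds.1 hq.2.2.2 j
  exact (Complex.continuous_exp.tendsto _).comp
    (((continuous_ofReal.tendsto _).comp hψ).const_mul I)

namespace Circuit

variable (p : Circuit)

/-- The coefficient of the interference term of a pair; a plus sign, since the signs of the
subtraction and of the interference cancel. -/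
theorem sum_ξ_sqrt (j : Fin 2) :
    p.ξ (plusDet j) * (√(p.g₁ (plusDet j)) * √(p.g₂ (plusDet j)))
      + p.ξ (minusDet j) * (√(p.g₁ (minusDet j)) * √(p.g₂ (minusDet j))) = p.κ₃ j := by
  have hη := fun j => (p.η_pos j).le
  have hη' : ∀ j, 0 ≤ 1 - p.η j := fun j => by linarith [p.η_lt_one j]
  have hε := fun j => Real.mul_self_sqrt (p.ε_pos j).le
  fin_cases j
  · simp [plusDet, minusDet, g₁, g₂, κ₃, Real.sqrt_mul, hη, hη', mul_nonneg]
    linear_combination √(p.η 0) * √(p.η 1) * √(p.η 2) * √(1 - p.η 2) *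
      (p.ξ 0 * hε 0 + p.ξ 2 * hε 2)
  · simp [plusDet, minusDet, g₁, g₂, κ₃, Real.sqrt_mul, hη, hη', mul_nonneg]
    linear_combination √(1 - p.η 0) * √(1 - p.η 1) * √(p.η 3) * √(1 - p.η 3) *
      (p.ξ 1 * hε 1 + p.ξ 3 * hε 3)

/-- The coefficient of the quadratic term of a pair. -/
theorem sum_ξ_sq_g₂ (j : Fin 2) :
    p.ξ (plusDet j) ^ 2 * p.g₂ (plusDet j) + p.ξ (minusDet j) ^ 2 * p.g₂ (minusDet j) = p.κ₂ j := by
  fin_cases j <;> simp [plusDet, minusDet, g₂, κ₂] <;> ring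

/-- The coefficient of the divergent term of a pair, where only the sign of the subtraction enters.
-/
theorem sub_ξ_g₂ (j : Fin 2) :
    p.ξ (plusDet j) * p.g₂ (plusDet j) - p.ξ (minusDet j) * p.g₂ (minusDet j) = p.Δ₂ j := by
  fin_cases j <;> simp [plusDet, minusDet, g₂, Δ₂] <;> ring

end Circuit

theorem sum_det (f : Fin 4 → ℂ) : ∑ i, f i = ∑ j, (f (plusDet j) + f (minusDet j)) := by
  simp [Fin.sum_univ_four, Fin.sum_univ_two, plusDet, minusDet]
  ring

theorem phaseIdx_plusDet (j : Fin 2) : phaseIdx (plusDet j) = j := by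
  fin_cases j <;> rfl

theorem phaseIdx_minusDet (j : Fin 2) : phaseIdx (minusDet j) = j := by
  fin_cases j <;> rfl

theorem detSign_plusDet (j : Fin 2) : detSign (plusDet j) = 1 := by
  fin_cases j <;> rfl

theorem detSign_minusDet (j : Fin 2) : detSign (minusDet j) = -1 := by
  fin_cases j <;> rfl

/-! ### The strong local oscillator limit for fixed amplitudes -/

section Limit

variable {T : ℝ} {u v : ℝ → ℂ} {K : Fin 2 → ℝ → ℝ} {q : ℝ → Circuit} {p : Circuit}
  {w : ℝ → Fin 2 → ℝ} {w₀ : Fin 2 → ℝ}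

/-- The contribution of one detector to the logarithm of the characteristic functional, up to the
term that diverges with the local oscillator. -/
theorem tendsto_detector (hu : MemLp u 2 (volume.restrict (Ioo 0 T)))
    (hv : MemLp v 2 (volume.restrict (Ioo 0 T))) (hK : IsTest K) (hq : CircuitTendsto q p)
    (hw : ∀ j, Tendsto (fun L => w L j) atTop (𝓝 (w₀ j))) (i : Fin 4) :
    Tendsto (fun L : ℝ => (∫ t in Ioo 0 T,
        (Complex.exp (I * pairPhase (q L) (fun j => w L j / L) K i t) - 1) *
          intensity (q L) i u (fun t => L * v t) t)
        - I * L * (detSign i * (q L).ξ i * w L (phaseIdx i)) * (q L).g₂ i *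
          ∫ t in Ioo 0 T, K (phaseIdx i) t * (‖v t‖ : ℂ) ^ 2) atTop
      (𝓝 (I * (p.ξ i * w₀ (phaseIdx i)) * (√(p.g₁ i) * √(p.g₂ i) : ℝ) *
          (I * p.ph (phaseIdx i) * (∫ t in Ioo 0 T, K (phaseIdx i) t * (conj (u t) * v t))
          - I * conj (p.ph (phaseIdx i)) * ∫ t in Ioo 0 T, K (phaseIdx i) t * (conj (v t) * u t))
        - (p.ξ i * w₀ (phaseIdx i)) ^ 2 / 2 * p.g₂ i *
          ∫ t in Ioo 0 T, K (phaseIdx i) t * (K (phaseIdx i) t * (‖v t‖ : ℂ) ^ 2))) := by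
  obtain ⟨hKm, hKb⟩ := hK (phaseIdx i)
  have huu := integrable_ofReal_norm_sq hu
  have hvv := integrable_ofReal_norm_sq hv
  have huv := integrable_mul_conj hu hv
  have hvu := integrable_mul_conj hv hu
  have hξ := tendsto_pi_nhds.1 hq.2.2.1 i
  have hc : Tendsto (fun L => detSign i * (q L).ξ i * w L (phaseIdx i)) atTop
      (𝓝 (detSign i * p.ξ i * w₀ (phaseIdx i))) := (hξ.const_mul _).mul (hw _)
  set j := phaseIdx i
  set c : ℝ → ℝ := fun L => detSign i * (q L).ξ i * w L j
  have d1 := tendsto_integral_exp_sub_one hKm hc huu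
  have d2 := tendsto_integral_mul_exp hKm hKb hc huv
  have d3 := tendsto_integral_mul_exp hKm hKb hc hvu
  have d4 := tendsto_integral_sq_mul_exp hKm hKb hc hvv
  have hg1 := (continuous_ofReal.tendsto _).comp (tendsto_g₁ hq i)
  have hg2 := (continuous_ofReal.tendsto _).comp (tendsto_g₂ hq i)
  have hr := ((continuous_ofReal.tendsto _).comp
    ((tendsto_g₁ hq i).sqrt.mul (tendsto_g₂ hq i).sqrt)).const_mul (detSign i : ℂ)
  have hph := (tendsto_ph hq j).const_mul I
  have hph' := ((continuous_conj.tendsto _).comp (tendsto_ph hq j)).const_mul I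
  have hlim := ((hg1.mul d1).add (hr.mul ((hph.mul d2).sub (hph'.mul d3)))).add (hg2.mul d4)
  refine (hlim.congr' ?_).trans_eq ?_
  · filter_upwards [eventually_gt_atTop 0] with L hL
    have hL' : (L : ℂ) ≠ 0 := by exact_mod_cast hL.ne'
    have hθ (t : ℝ) : pairPhase (q L) (fun j => w L j / L) K i t = c L * K j t / L := by
      simp only [pairPhase, c, j]
      ring
    have hem : AEStronglyMeasurable (fun t => Complex.exp (I * (c L * K j t / L : ℝ)) - 1)
        (volume.restrict (Ioo 0 T)) := Measurable.aestronglyMeasurable (by fun_prop)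
    have heb : ∀ᵐ t ∂volume.restrict (Ioo 0 T),
        ‖Complex.exp (I * (c L * K j t / L : ℝ)) - 1‖ ≤ 2 := by
      refine Eventually.of_forall fun t => (norm_sub_le _ _).trans ?_
      rw [norm_exp_I_mul_ofReal, norm_one]
      norm_num
    set e : ℝ → ℂ := fun t => Complex.exp (I * (c L * K j t / L : ℝ)) - 1 with he
    have i1 : Integrable (fun t => e t * (‖u t‖ : ℂ) ^ 2) (volume.restrict (Ioo 0 T)) :=
      huu.bdd_mul hem heb
    have i2 : Integrable (fun t => L * e t * (conj (u t) * v t)) (volume.restrict (Ioo 0 T)) := by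
      simpa only [mul_assoc] using (huv.bdd_mul hem heb).const_mul (L : ℂ)
    have i3 : Integrable (fun t => L * e t * (conj (v t) * u t)) (volume.restrict (Ioo 0 T)) := by
      simpa only [mul_assoc] using (hvu.bdd_mul hem heb).const_mul (L : ℂ)
    have i5 := hK.integrable_mul j hvv
    have i4 : Integrable (fun t => (L : ℂ) ^ 2 * (e t - I * (c L * K j t / L : ℝ)) *
        (‖v t‖ : ℂ) ^ 2) (volume.restrict (Ioo 0 T)) := by
      refine (((hvv.bdd_mul hem heb).sub (i5.const_mul (I * c L / L))).const_mul
        ((L : ℂ) ^ 2)).congr (Eventually.of_forall fun t => ?_)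
      simp only [he, Pi.sub_apply]
      push_cast
      ring
    -- The last summand pairs the first-order phase with `L² g₂ |v|²`; it is exactly the divergent
    -- term subtracted in the statement. The others match `d1`–`d4`.
    have hsplit : (fun t => (Complex.exp (I * pairPhase (q L) (fun j => w L j / L) K i t) - 1) *
          intensity (q L) i u (fun t => L * v t) t) = fun t =>
        ((q L).g₁ i * (e t * (‖u t‖ : ℂ) ^ 2)
        + detSign i * (√((q L).g₁ i) * √((q L).g₂ i) : ℝ) *
          (I * (q L).ph j * (L * e t * (conj (u t) * v t))
            - I * conj ((q L).ph j) * (L * e t * (conj (v t) * u t)))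
        + (q L).g₂ i * ((L : ℂ) ^ 2 * (e t - I * (c L * K j t / L : ℝ)) * (‖v t‖ : ℂ) ^ 2))
        + I * L * c L * (q L).g₂ i * (K j t * (‖v t‖ : ℂ) ^ 2) := by
      funext t
      rw [hθ, intensity_eq]
      simp only [he]
      push_cast
      field_simp
      ring
    have k1 := i1.const_mul ((q L).g₁ i : ℂ)
    have k2 := (i2.const_mul (I * (q L).ph j)).sub (i3.const_mul (I * conj ((q L).ph j)))
    have k3 := k2.const_mul (detSign i * (√((q L).g₁ i) * √((q L).g₂ i) : ℝ) : ℂ)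
    have k4 := i4.const_mul ((q L).g₂ i : ℂ)
    have k5 := i5.const_mul (I * L * c L * (q L).g₂ i)
    have h1 := integral_add ((k1.add k3).add k4) k5
    have h2 := integral_add (k1.add k3) k4
    have h3 := integral_add k1 k3
    have h4 := integral_sub (i2.const_mul (I * (q L).ph j)) (i3.const_mul (I * conj ((q L).ph j)))
    simp only [Pi.add_apply, Pi.sub_apply, integral_const_mul] at h1 h2 h3 h4
    rw [hsplit, h1, h2, h3, h4]
    simp only [Function.comp_apply, he, c]
    push_cast
    ring
  -- The sign of the detector appears twice in both the interference and the quadratic terms, and so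
  -- disappears.
  · have hs : (detSign i : ℂ) * detSign i = 1 := by exact_mod_cast detSign_mul_self i
    congr 1
    push_cast
    generalize (∫ t in Ioo 0 T, K j t * (conj (u t) * v t)) = a
    generalize (∫ t in Ioo 0 T, K j t * (conj (v t) * u t)) = a'
    generalize (∫ t in Ioo 0 T, K j t * (K j t * (‖v t‖ : ℂ) ^ 2)) = b
    linear_combination (I * (p.ξ i * w₀ j) * (√(p.g₁ i) * √(p.g₂ i)) *
      (I * p.ph j * a - I * conj (p.ph j) * a')
        - (p.ξ i * w₀ j) ^ 2 / 2 * p.g₂ i * b) * hs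

/-- Limit of strong local oscillator for Poisson processes with weights of order `1 / L`. -/
theorem tendsto_strong_oscillator {G : Fin 2 → ℝ} (hu : MemLp u 2 (volume.restrict (Ioo 0 T)))
    (hv : MemLp v 2 (volume.restrict (Ioo 0 T))) (hK : IsTest K) (hq : CircuitTendsto q p)
    (hG : ∀ᶠ L in atTop, ∀ j, G j = (q L).Δ₂ j * L / (q L).κ₃ j)
    (hw : ∀ j, Tendsto (fun L => w L j) atTop (𝓝 (w₀ j))) :
    Tendsto (fun L : ℝ => Complex.exp (∑ i, ∫ t in Ioo 0 T,
        (Complex.exp (I * pairPhase (q L) (fun j => w L j / L) K i t) - 1) *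
          intensity (q L) i u (fun t => L * v t) t)) atTop
      (𝓝 (phiZ p G T (fun j t => p.κ₃ j * (w₀ j * K j t)) u v)) := by
  have hK' : IsTest fun j t => p.κ₃ j * (w₀ j * K j t) := by
    intro j
    obtain ⟨hm, C, hC⟩ := hK j
    refine ⟨(hm.const_mul _).const_mul _, |p.κ₃ j| * (|w₀ j| * C), fun t => ?_⟩
    rw [abs_mul, abs_mul]
    exact mul_le_mul_of_nonneg_left (mul_le_mul_of_nonneg_left (hC t) (abs_nonneg _))
      (abs_nonneg _)
  rw [phiZ_eq p G hu hv hK']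
  refine (Complex.continuous_exp.tendsto _).comp ?_
  have hvv := integrable_ofReal_norm_sq hv
  have huv := integrable_mul_conj hu hv
  have hvu := integrable_mul_conj hv hu
  have hdet := tendsto_finsetSum Finset.univ fun i _ =>
    tendsto_detector hu hv hK hq hw i
  -- What the divergent terms of each pair amount to once `Δ₂ L / κ₃` is held at `G`.
  have hdiv : Tendsto (fun L : ℝ => ∑ j, I * (w L j * ((q L).κ₃ j * G j) : ℝ) *
      ∫ t in Ioo 0 T, K j t * (‖v t‖ : ℂ) ^ 2) atTop
      (𝓝 (∑ j, I * (w₀ j * (p.κ₃ j * G j) : ℝ) * ∫ t in Ioo 0 T, K j t * (‖v t‖ : ℂ) ^ 2)) := by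
    refine tendsto_finsetSum _ fun j _ => Tendsto.mul_const _ (Tendsto.const_mul _ ?_)
    exact (continuous_ofReal.tendsto _).comp ((hw j).mul ((tendsto_κ₃ hq j).mul_const _))
  refine ((hdet.add hdiv).congr' ?_).trans_eq ?_
  · filter_upwards [hG] with L hL
    rw [Finset.sum_sub_distrib, sub_add_eq_add_sub, sub_eq_iff_eq_add]
    congr 1
    rw [sum_det]
    refine Finset.sum_congr rfl fun j _ => ?_
    have h1 : (q L).κ₃ j * G j = L * ((q L).ξ (plusDet j) * (q L).g₂ (plusDet j)
        - (q L).ξ (minusDet j) * (q L).g₂ (minusDet j)) := by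
      rw [hL j, (q L).sub_ξ_g₂, mul_div_cancel₀ _ ((q L).κ₃_pos j).ne', mul_comm]
    rw [h1, phaseIdx_plusDet, phaseIdx_minusDet, detSign_plusDet, detSign_minusDet]
    push_cast
    ring
  · congr 1
    rw [sum_det, ← Finset.sum_add_distrib]
    refine Finset.sum_congr rfl fun j _ => ?_
    have i1 := hK.integrable_mul j hvv
    have i2 := hK.integrable_mul j huv
    have i3 := hK.integrable_mul j hvu
    have i4 := hK.integrable_mul j i1
    -- The factor `κ₃` in the test function cancels the denominator of `κ₂ / (2 κ₃²)`.
    have hint : ∀ t, (I * ((p.κ₃ j * (w₀ j * K j t) : ℝ) : ℂ) * (G j * ‖v t‖ ^ 2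
          + (I * Complex.exp (I * p.ψ j) * conj (u t) * v t
            + conj (I * Complex.exp (I * p.ψ j) * conj (u t) * v t)))
        - p.κ₂ j / (2 * p.κ₃ j ^ 2) * ((p.κ₃ j * (w₀ j * K j t) : ℝ) : ℂ) ^ 2 * ‖v t‖ ^ 2) =
        I * p.κ₃ j * w₀ j * (G j * (K j t * (‖v t‖ : ℂ) ^ 2)
          + (I * p.ph j * (K j t * (conj (u t) * v t))
            - I * conj (p.ph j) * (K j t * (conj (v t) * u t))))
        - p.κ₂ j * w₀ j ^ 2 / 2 * (K j t * (K j t * (‖v t‖ : ℂ) ^ 2)) := by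
      intro t
      have hκ : (p.κ₃ j : ℂ) ≠ 0 := by exact_mod_cast (p.κ₃_pos j).ne'
      simp only [Circuit.ph, map_mul, conj_I, conj_conj]
      push_cast
      field_simp
      ring
    simp only [hint]
    have k2 := i2.const_mul (I * p.ph j)
    have k3 := i3.const_mul (I * conj (p.ph j))
    have k1 := i1.const_mul (G j : ℂ)
    have k5 := (k1.add (k2.sub k3)).const_mul (I * p.κ₃ j * w₀ j)
    have h1 := integral_sub k5 (i4.const_mul (p.κ₂ j * w₀ j ^ 2 / 2 : ℂ))
    have h2 := integral_add k1 (k2.sub k3)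
    have h3 := integral_sub k2 k3
    simp only [Pi.add_apply, Pi.sub_apply, integral_const_mul] at h1 h2 h3
    rw [h1, h2, h3]
    have e1 : (p.ξ (plusDet j) * (√(p.g₁ (plusDet j)) * √(p.g₂ (plusDet j)))
      + p.ξ (minusDet j) * (√(p.g₁ (minusDet j)) * √(p.g₂ (minusDet j))) : ℂ) = p.κ₃ j := by
      exact_mod_cast p.sum_ξ_sqrt j
    have e2 : (p.ξ (plusDet j) ^ 2 * p.g₂ (plusDet j)
      + p.ξ (minusDet j) ^ 2 * p.g₂ (minusDet j) : ℂ) = p.κ₂ j := by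
      exact_mod_cast p.sum_ξ_sq_g₂ j
    rw [phaseIdx_plusDet, phaseIdx_minusDet]
    push_cast
    linear_combination
      I * w₀ j * (I * p.ph j * (∫ t in Ioo 0 T, K j t * (conj (u t) * v t))
          - I * conj (p.ph j) * ∫ t in Ioo 0 T, K j t * (conj (v t) * u t)) * e1
      - w₀ j ^ 2 / 2 * (∫ t in Ioo 0 T, K j t * (K j t * (‖v t‖ : ℂ) ^ 2)) * e2

end Limit

/-! ### Uniform bound and measurability in the random amplitudes -/

/-- The real part of each exponent is `∫ (cos θ - 1) J ≤ 0`; if the integrand is not integrable, the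
integral is `0` by convention and the bound persists. -/
theorem norm_exp_integral_le_one {T : ℝ} (θ : Fin 4 → ℝ → ℝ) (J : Fin 4 → ℝ → ℝ)
    (hJ : ∀ i t, 0 ≤ J i t) :
    ‖Complex.exp (∑ i, ∫ t in Ioo 0 T, (Complex.exp (I * θ i t) - 1) * J i t)‖ ≤ 1 := by
  rw [Complex.norm_exp, Real.exp_le_one_iff, re_sum]
  refine Finset.sum_nonpos fun i _ => ?_
  by_cases h : Integrable (fun t => (Complex.exp (I * θ i t) - 1) * (J i t : ℂ))
      (volume.restrict (Ioo 0 T))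
  · have h1 := integral_re h
    simp only [RCLike.re_eq_complex_re] at h1
    rw [← h1]
    refine integral_nonpos fun t => ?_
    have h2 : (Complex.exp (I * θ i t)).re = Real.cos (θ i t) := by
      rw [mul_comm, exp_ofReal_mul_I_re]
    simp only [mul_re, sub_re, one_re, ofReal_re, ofReal_im, mul_zero, sub_zero, h2, Pi.zero_apply]
    exact mul_nonpos_of_nonpos_of_nonneg (by linarith [Real.cos_le_one (θ i t)]) (hJ i t)
  · rw [integral_undef h, zero_re]

theorem intensity_nonneg (p : Circuit) (j : Fin 4) (u v : ℝ → ℂ) (t : ℝ) :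
    0 ≤ intensity p j u v t := sq_nonneg _

/-- Measurability in `ω` is read off the explicit exponent; `condPhiY` inherits it almost everywhere
through `condPhiY_eq`. -/
theorem measurable_condPhi {Ω : Type*} [MeasurableSpace Ω] (p : Circuit) (T L : ℝ)
    {fs ft : Ω → ℝ → ℂ} (hfs : Measurable fun x : Ω × ℝ => fs x.1 x.2)
    (hft : Measurable fun x : Ω × ℝ => ft x.1 x.2) {θ : Fin 4 → ℝ → ℝ}
    (hθ : ∀ i, Measurable (θ i)) :
    Measurable fun ω => Complex.exp (∑ i, ∫ t in Ioo 0 T, (Complex.exp (I * θ i t) - 1) *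
      intensity p i (fs ω) (fun t => L * ft ω t) t) := by
  refine Complex.measurable_exp.comp (Finset.measurable_fun_sum _ fun i _ => ?_)
  refine (StronglyMeasurable.integral_prod_right (f := fun ω t =>
    (Complex.exp (I * θ i t) - 1) * (intensity p i (fs ω) (fun t => L * ft ω t) t : ℂ))
    (Measurable.stronglyMeasurable ?_)).measurable
  have h1 : Measurable fun x : Ω × ℝ => θ i x.2 := (hθ i).comp measurable_snd
  simp only [Function.uncurry_def, intensity]
  fun_prop

end Homodyne

end

/-! ### Assembly of the three statements -/

theorem corollary1
    {Ω : Type*} [MeasurableSpace Ω] (Pf : Measure Ω) [IsProbabilityMeasure Pf]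
    (T : ℝ) (hT : 0 < T)
    (fs ft : Ω → ℝ → ℂ)
    (hfs : Measurable fun x : Ω × ℝ => fs x.1 x.2)
    (hft : Measurable fun x : Ω × ℝ => ft x.1 x.2)
    (hfs2 : ∀ᵐ ω ∂Pf, MemLp (fs ω) 2 (volume.restrict (Set.Ioo 0 T)))
    (hft2 : ∀ᵐ ω ∂Pf, MemLp (ft ω) 2 (volume.restrict (Set.Ioo 0 T)))
    (h : ℝ → ℝ) (hmeas : Measurable h) (hpos : ∀ t, 0 ≤ h t)
    (hint : ∫ t in Set.Ioi 0, h t = 1)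
    (p : Homodyne.Circuit) (G : Fin 2 → ℝ) :
    -- the explicit form of the conditional characteristic functional
    (∀ᵐ ω ∂Pf, ∀ k : Fin 2 → ℝ → ℝ, Homodyne.IsTest k →
      Homodyne.phiZ p G T k (fs ω) (ft ω) =
        Complex.exp (∑ j, ∫ t in Set.Ioo 0 T,
          (I * k j t * (G j * ‖ft ω t‖ ^ 2
              + (I * Complex.exp (I * p.ψ j) * conj (fs ω t) * ft ω t
                + conj (I * Complex.exp (I * p.ψ j) * conj (fs ω t) * ft ω t)))
            - p.κ₂ j / (2 * p.κ₃ j ^ 2) * (k j t) ^ 2 * ‖ft ω t‖ ^ 2))) ∧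
    -- given the amplitudes, the counts are Poisson processes with intensities `J_j`
    (∀ᵐ ω ∂Pf, ∀ k : Fin 4 → ℝ → ℝ, Homodyne.IsTest k → ∀ L : ℝ, 0 < L →
      Homodyne.condPhiN p T k (fs ω) (fun t => L * ft ω t) =
        Complex.exp (∑ j, ∫ t in Set.Ioo 0 T, (Complex.exp (I * k j t) - 1) *
          Homodyne.intensity p j (fs ω) (fun t => L * ft ω t) t)) ∧
    -- the limit of strong local oscillator, with `G_{j2}` kept independent of `L`
    (∀ q : ℝ → Homodyne.Circuit, Homodyne.CircuitTendsto q p →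
      (∀ᶠ L in atTop, ∀ j, G j = (q L).Δ₂ j * L / (q L).κ₃ j) →
      (∀ᵐ ω ∂Pf, ∀ k : Fin 2 → ℝ → ℝ, Homodyne.IsTest k →
        Tendsto (fun L : ℝ => Homodyne.condPhiZ (q L) T L k (fs ω) (ft ω)) atTop
          (𝓝 (Homodyne.phiZ p G T k (fs ω) (ft ω)))) ∧
      ∀ k : Fin 2 → ℝ → ℝ, Homodyne.IsTest k →
        (∀ L : ℝ, 0 < L →
          Integrable (fun ω => Homodyne.condPhiY (q L) h T L k (fs ω) (ft ω)) Pf) ∧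
        Integrable (fun ω => Homodyne.phiZ p G T (Homodyne.smoothed p h T k) (fs ω) (ft ω)) Pf ∧
        Tendsto (fun L : ℝ => ∫ ω, Homodyne.condPhiY (q L) h T L k (fs ω) (ft ω) ∂Pf) atTop
          (𝓝 (∫ ω, Homodyne.phiZ p G T (Homodyne.smoothed p h T k) (fs ω) (ft ω) ∂Pf))) := by
  -- A non-integrable `h` would have integral `0`, not `1`.
  have hi : IntegrableOn h (Ioi 0) := by
    by_contra hn
    rw [integral_undef hn] at hint
    exact zero_ne_one hint
  refine ⟨?_, ?_, fun q hq hG => ⟨?_, fun k hk => ?_⟩⟩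
  · filter_upwards [hfs2, hft2] with ω hu hv k hk
    exact Homodyne.phiZ_eq p G hu hv hk
  · filter_upwards [hfs2, hft2] with ω hu hv k hk L _
    exact Homodyne.condPhiN_eq p hu (hv.const_mul (L : ℂ)) fun j => (hk j).1
  · filter_upwards [hfs2, hft2] with ω hu hv k hk
    -- For `Z` the weights `1 / κ₃` depend on `L`, and in the limit they cancel the factor `κ₃` of
    -- the general statement.
    have hw (j : Fin 2) : Tendsto (fun L => 1 / (q L).κ₃ j) atTop (𝓝 (1 / p.κ₃ j)) :=
      tendsto_const_nhds.div (Homodyne.tendsto_κ₃ hq j) (p.κ₃_pos j).ne'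
    have hlim := Homodyne.tendsto_strong_oscillator (w := fun L j => 1 / (q L).κ₃ j)
      (w₀ := fun j => 1 / p.κ₃ j) hu hv hk hq hG hw
    have hk' : (fun j t => p.κ₃ j * (1 / p.κ₃ j * k j t)) = k := by
      funext j t
      rw [← mul_assoc, mul_one_div_cancel (p.κ₃_pos j).ne', one_mul]
    rw [hk'] at hlim
    exact hlim.congr fun L => (Homodyne.condPhiZ_eq (q L) L hu hv fun j => (hk j).1).symm
  · have hR := Homodyne.isTest_response (T := T) hmeas hpos hi hk
    -- The exceptional null set does not depend on `L`, which the pointwise limit requires.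
    have hY : ∀ᵐ ω ∂Pf, ∀ L : ℝ, Homodyne.condPhiY (q L) h T L k (fs ω) (ft ω) =
        Complex.exp (∑ j, ∫ t in Ioo 0 T, (Complex.exp (I * Homodyne.pairPhase (q L)
          (fun _ => 1 / L) (Homodyne.response h T k) j t) - 1) *
          Homodyne.intensity (q L) j (fs ω) (fun t => L * ft ω t) t) := by
      filter_upwards [hfs2, hft2] with ω hu hv L
      exact Homodyne.condPhiY_eq (q L) hmeas hpos hi L hu hv hk
    have hYm (L : ℝ) : AEStronglyMeasurable
        (fun ω => Homodyne.condPhiY (q L) h T L k (fs ω) (ft ω)) Pf := by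
      refine (Homodyne.measurable_condPhi (q L) T L hfs hft
        (Homodyne.measurable_pairPhase (q L) (fun _ => 1 / L)
          fun j => (hR j).1)).aestronglyMeasurable.congr ?_
      filter_upwards [hY] with ω hω
      exact (hω L).symm
    have hYb : ∀ᵐ ω ∂Pf, ∀ L : ℝ, ‖Homodyne.condPhiY (q L) h T L k (fs ω) (ft ω)‖ ≤ 1 := by
      filter_upwards [hY] with ω hω L
      rw [hω L]
      exact Homodyne.norm_exp_integral_le_one _ _ fun i t => Homodyne.intensity_nonneg _ _ _ _ _
    have hlim : ∀ᵐ ω ∂Pf, Tendsto (fun L : ℝ => Homodyne.condPhiY (q L) h T L k (fs ω) (ft ω))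
        atTop (𝓝 (Homodyne.phiZ p G T (Homodyne.smoothed p h T k) (fs ω) (ft ω))) := by
      filter_upwards [hfs2, hft2, hY] with ω hu hv hω
      -- For `X / L` the weight is `1`, so the limiting `κ₃` remains and turns `response` into
      -- `smoothed`.
      have h1 := Homodyne.tendsto_strong_oscillator (w := fun _ _ => 1) (w₀ := fun _ => 1)
        hu hv hR hq hG fun j => tendsto_const_nhds
      simp only [one_mul] at h1
      exact h1.congr fun L => (hω L).symm
    refine ⟨fun L _ => Integrable.of_bound (hYm L) 1 (hYb.mono fun ω hω => hω L), ?_, ?_⟩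
    -- Measurability and the bound `1` pass to `Φ^Z` as an almost sure limit.
    · refine Integrable.of_bound (aestronglyMeasurable_of_tendsto_ae atTop hYm hlim) 1 ?_
      filter_upwards [hYb, hlim] with ω hω hωl
      exact le_of_tendsto hωl.norm (Eventually.of_forall hω)
    · exact tendsto_integral_filter_of_dominated_convergence (fun _ => 1)
        (Eventually.of_forall hYm) (Eventually.of_forall fun L => hYb.mono fun ω hω => hω L)
        (integrable_const 1) hlim
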